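/- Let $\varrho\in\mathbb Q$ and let $W(\varrho)[0]$ be the complex Lie algebra with basis $\{L_n, Y_p \mid n,p\in\mathbb Z\}$ and brackets $$[L_m,L_n]=(n-m)L_{m+n},\qquad [L_m,Y_p]=(p-m\varrho)Y_{m+p},\qquad [Y_p,Y_q]=0 .$$ For $a,b,c\in\mathbb C$ with $\varrho=0$ or $c=0$, let $\mathcal A_{a,b,c}$ be the $W(\varrho)[0]$-module with basis $\{v_i\mid i\in\mathbb Z\}$ and actions $$L_m v_i=(a+i+bm)\,v_{m+i},\qquad Y_p v_i=c\,v_{p+i}\qquad (m,p,i\in\mathbb Z),$$ and let $\mathcal A'_{a,b,c}$ denote the nontrivial simple subquotient of $\mathcal A_{a,b,c}$ (which is $\mathcal A_{a,b,c}$ itself if that module is irreducible); here a module is called trivial if the Lie algebra acts on it by zero. Let $V$ be a nontrivial irreducible $W(\varrho)[0]$-module that is a weight module, i.e. $V$ is the sum of its weight spaces $V^\mu=\{v\in V\mid L_0v=\mu v\}$, $\mu\in\mathbb C$, and suppose that every nonzero weight space is one-dimensional. (1) If $\varrho=0$, then $V\cong\mathcal A'_{a,b,c}$ for some $a,b,c\in\mathbb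 C$. (2) If $\varrho\neq 0,-1$, then $V\cong\mathcal A'_{a,b,0}$ for some $a,b\in\mathbb C$; in particular every $Y_p$ acts as zero on $V$. -/

import Mathlib

noncomputable section

/-- The underlying vector space of the Lie algebra `W(ϱ)[0]`: the free complex vector space on
the symbols `L_n` (index `Sum.inl n`) and `Y_p` (index `Sum.inr p`), with `n, p` integers. -/
def WAlg (_ϱ : ℚ) : Type := (ℤ ⊕ ℤ) →₀ ℂ

namespace WAlg

variable (ϱ : ℚ)

instance : AddCommGroup (WAlg ϱ) := inferInstanceAs (AddCommGroup ((ℤ ⊕ ℤ) →₀ ℂ))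

instance : Module ℂ (WAlg ϱ) := inferInstanceAs (Module ℂ ((ℤ ⊕ ℤ) →₀ ℂ))

/-- The basis `{L_n, Y_p}`. -/
def basis : Module.Basis (ℤ ⊕ ℤ) ℂ (WAlg ϱ) := Module.Basis.ofRepr (LinearEquiv.refl ℂ _)

/-- The basis element `L_n`. -/
def L (n : ℤ) : WAlg ϱ := basis ϱ (Sum.inl n)

/-- The basis element `Y_p`. -/
def Y (p : ℤ) : WAlg ϱ := basis ϱ (Sum.inr p)

/-- The bracket of two basis elements. -/
def basisBracket : ℤ ⊕ ℤ → ℤ ⊕ ℤ → WAlg ϱ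
  | Sum.inl m, Sum.inl n => ((n : ℂ) - m) • L ϱ (m + n)
  | Sum.inl m, Sum.inr p => ((p : ℂ) - m * ϱ) • Y ϱ (m + p)
  | Sum.inr p, Sum.inl m => -(((p : ℂ) - m * ϱ) • Y ϱ (m + p))
  | Sum.inr _, Sum.inr _ => 0

/-- The bilinear extension of `basisBracket`. -/
def bracketHom : WAlg ϱ →ₗ[ℂ] WAlg ϱ →ₗ[ℂ] WAlg ϱ :=
  (basis ϱ).constr ℂ fun x => (basis ϱ).constr ℂ fun y => basisBracket ϱ x y

theorem bracketHom_basis (x y : ℤ ⊕ ℤ) :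
    bracketHom ϱ (basis ϱ x) (basis ϱ y) = basisBracket ϱ x y := by
  simp [bracketHom, Module.Basis.constr_basis]

theorem bracketHom_skew (u v : WAlg ϱ) : bracketHom ϱ u v = -bracketHom ϱ v u := by
  have h : bracketHom ϱ = -(bracketHom ϱ).flip := by
    refine (basis ϱ).ext fun x => (basis ϱ).ext fun y => ?_
    simp only [LinearMap.neg_apply, LinearMap.flip_apply, bracketHom_basis]
    rcases x with m | p <;> rcases y with n | q <;> simp [basisBracket]
    rw [add_comm n m, ← neg_smul]
    congr 1
    ring
  exact DFunLike.congr_fun (DFunLike.congr_fun h u) v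

/-- A property of elements of `W(ϱ)[0]` that is linear holds as soon as it holds on the basis. -/
theorem induction_basis {P : WAlg ϱ → Prop} (u : WAlg ϱ) (hb : ∀ x, P (basis ϱ x)) (h0 : P 0)
    (ha : ∀ u v, P u → P v → P (u + v)) (hs : ∀ (c : ℂ) u, P u → P (c • u)) : P u := by
  have hu : u ∈ Submodule.span ℂ (Set.range (basis ϱ)) := by
    rw [(basis ϱ).span_eq]; exact Submodule.mem_top
  induction hu using Submodule.span_induction with
  | mem x hx => obtain ⟨i, rfl⟩ := hx; exact hb i
  | zero => exact h0
  | add x y _ _ hx hy => exact ha x y hx hy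
  | smul c x _ hx => exact hs c x hx

theorem bracketHom_LL (m n : ℤ) : bracketHom ϱ (L ϱ m) (L ϱ n) = ((n : ℂ) - m) • L ϱ (m + n) :=
  bracketHom_basis ϱ (Sum.inl m) (Sum.inl n)

theorem bracketHom_LY (m p : ℤ) :
    bracketHom ϱ (L ϱ m) (Y ϱ p) = ((p : ℂ) - m * ϱ) • Y ϱ (m + p) :=
  bracketHom_basis ϱ (Sum.inl m) (Sum.inr p)

theorem bracketHom_YL (p m : ℤ) :
    bracketHom ϱ (Y ϱ p) (L ϱ m) = -(((p : ℂ) - m * ϱ) • Y ϱ (m + p)) :=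
  bracketHom_basis ϱ (Sum.inr p) (Sum.inl m)

theorem bracketHom_YY (p q : ℤ) : bracketHom ϱ (Y ϱ p) (Y ϱ q) = 0 :=
  bracketHom_basis ϱ (Sum.inr p) (Sum.inr q)

theorem bracketHom_jacobi (u v w : WAlg ϱ) :
    bracketHom ϱ u (bracketHom ϱ v w) =
      bracketHom ϱ (bracketHom ϱ u v) w + bracketHom ϱ v (bracketHom ϱ u w) := by
  refine induction_basis ϱ (P := fun u => bracketHom ϱ u (bracketHom ϱ v w) =
      bracketHom ϱ (bracketHom ϱ u v) w + bracketHom ϱ v (bracketHom ϱ u w)) u (fun x => ?_) (by simp)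
    (fun s t ha hb => by simp only [map_add, LinearMap.add_apply, ha, hb]; abel)
    (fun d s ha => by simp only [map_smul, LinearMap.smul_apply, ha, smul_add])
  refine induction_basis ϱ (P := fun v => bracketHom ϱ (basis ϱ x) (bracketHom ϱ v w) =
      bracketHom ϱ (bracketHom ϱ (basis ϱ x) v) w + bracketHom ϱ v (bracketHom ϱ (basis ϱ x) w)) v (fun y => ?_) (by simp)
    (fun s t ha hb => by simp only [map_add, LinearMap.add_apply, ha, hb]; abel)
    (fun d s ha => by simp only [map_smul, LinearMap.smul_apply, ha, smul_add])
  refine induction_basis ϱ (P := fun w => bracketHom ϱ (basis ϱ x) (bracketHom ϱ (basis ϱ y) w) =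
      bracketHom ϱ (bracketHom ϱ (basis ϱ x) (basis ϱ y)) w + bracketHom ϱ (basis ϱ y) (bracketHom ϱ (basis ϱ x) w)) w (fun z => ?_) (by simp)
    (fun s t ha hb => by simp only [map_add, ha, hb]; abel)
    (fun d s ha => by simp only [map_smul, ha, smul_add])
  have key : ∀ {c d e : ℂ} {i j k : ℤ} (f : ℤ → WAlg ϱ), i = j → i = k → c = d + e →
      c • f i = d • f j + e • f k := by
    rintro c d e i j k f rfl rfl rfl
    exact add_smul _ _ _
  rcases x with m | p <;> rcases y with n | q <;> rcases z with k | r <;>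
    simp only [← L.eq_1, ← Y.eq_1, bracketHom_LL, bracketHom_LY, bracketHom_YL, bracketHom_YY,
      map_smul, LinearMap.smul_apply, smul_smul, smul_zero, map_zero, LinearMap.zero_apply,
      add_zero, ← neg_smul]
  · refine key (L ϱ) (by ring) (by ring) ?_
    push_cast
    ring
  · refine key (Y ϱ) (by ring) (by ring) ?_
    push_cast
    ring
  · refine key (Y ϱ) (by ring) (by ring) ?_
    push_cast
    ring
  · refine key (Y ϱ) (by ring) (by ring) ?_
    push_cast
    ring

/-- The Lie bracket of `W(ϱ)[0]`. On the basis it is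
`[L_m, L_n] = (n - m) L_{m+n}`, `[L_m, Y_p] = (p - m ϱ) Y_{m+p}`, `[Y_p, Y_q] = 0`. -/
instance : LieRing (WAlg ϱ) where
  bracket u v := bracketHom ϱ u v
  add_lie u v w := by simp
  lie_add u v w := by simp
  lie_self u := by
    have h := bracketHom_skew ϱ u u
    have h2 : (2 : ℂ) • bracketHom ϱ u u = 0 := by
      rw [two_smul]
      nth_rewrite 1 [h]
      exact neg_add_cancel _
    exact (smul_eq_zero.mp h2).resolve_left two_ne_zero
  leibniz_lie u v w := bracketHom_jacobi ϱ u v w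

instance : LieAlgebra ℂ (WAlg ϱ) where
  lie_smul c u v := by simp [Bracket.bracket]

theorem lie_def (u v : WAlg ϱ) : ⁅u, v⁆ = bracketHom ϱ u v := rfl

theorem lie_L_L (m n : ℤ) : ⁅L ϱ m, L ϱ n⁆ = ((n : ℂ) - m) • L ϱ (m + n) :=
  bracketHom_LL ϱ m n

theorem lie_L_Y (m p : ℤ) : ⁅L ϱ m, Y ϱ p⁆ = ((p : ℂ) - m * ϱ) • Y ϱ (m + p) :=
  bracketHom_LY ϱ m p

theorem lie_Y_Y (p q : ℤ) : ⁅Y ϱ p, Y ϱ q⁆ = 0 :=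
  bracketHom_YY ϱ p q

end WAlg

/-- The underlying vector space of the module `A_{a,b,c}` over `W(ϱ)[0]`: the free complex vector
space on `{v_i | i ∈ ℤ}`. The module structure below requires `ϱ = 0` or `c = 0`. -/
def IntermediateModule (ϱ : ℚ) (_a _b c : ℂ) (_h : ϱ = 0 ∨ c = 0) : Type := ℤ →₀ ℂ

namespace IntermediateModule

variable (ϱ : ℚ) (a b c : ℂ) (h : ϱ = 0 ∨ c = 0)

instance : AddCommGroup (IntermediateModule ϱ a b c h) := inferInstanceAs (AddCommGroup (ℤ →₀ ℂ))

instance : Module ℂ (IntermediateModule ϱ a b c h) := inferInstanceAs (Module ℂ (ℤ →₀ ℂ))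

/-- The basis `{v_i | i ∈ ℤ}`. -/
def basis : Module.Basis ℤ ℂ (IntermediateModule ϱ a b c h) :=
  Module.Basis.ofRepr (LinearEquiv.refl ℂ _)

/-- The basis vector `v_i`. -/
def v (i : ℤ) : IntermediateModule ϱ a b c h := basis ϱ a b c h i

/-- The action of a basis element of `W(ϱ)[0]` on a basis vector `v_i`. -/
def basisAct : ℤ ⊕ ℤ → ℤ → IntermediateModule ϱ a b c h
  | Sum.inl m, i => (a + i + b * m) • v ϱ a b c h (m + i)
  | Sum.inr p, i => c • v ϱ a b c h (p + i)

/-- The bilinear extension of `basisAct`. -/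
def actHom : WAlg ϱ →ₗ[ℂ] IntermediateModule ϱ a b c h →ₗ[ℂ] IntermediateModule ϱ a b c h :=
  (WAlg.basis ϱ).constr ℂ fun x => (basis ϱ a b c h).constr ℂ fun i => basisAct ϱ a b c h x i

theorem actHom_L_v (m i : ℤ) : actHom ϱ a b c h (WAlg.L ϱ m) (v ϱ a b c h i) =
    (a + i + b * m) • v ϱ a b c h (m + i) := by
  simp [actHom, WAlg.L, v, Module.Basis.constr_basis, basisAct]

theorem actHom_Y_v (p i : ℤ) : actHom ϱ a b c h (WAlg.Y ϱ p) (v ϱ a b c h i) =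
    c • v ϱ a b c h (p + i) := by
  simp [actHom, WAlg.Y, v, Module.Basis.constr_basis, basisAct]

theorem actHom_leibniz (x y : WAlg ϱ) (u : IntermediateModule ϱ a b c h) :
    actHom ϱ a b c h x (actHom ϱ a b c h y u) =
      actHom ϱ a b c h ⁅x, y⁆ u + actHom ϱ a b c h y (actHom ϱ a b c h x u) := by
  rw [WAlg.lie_def]
  refine WAlg.induction_basis ϱ (P := fun x => actHom ϱ a b c h x (actHom ϱ a b c h y u) =
      actHom ϱ a b c h (WAlg.bracketHom ϱ x y) u + actHom ϱ a b c h y (actHom ϱ a b c h x u)) x (fun x => ?_) (by simp)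
    (fun s t ha hb => by simp only [map_add, LinearMap.add_apply, ha, hb]; abel)
    (fun d s ha => by simp only [map_smul, LinearMap.smul_apply, ha, smul_add])
  refine WAlg.induction_basis ϱ (P := fun y => actHom ϱ a b c h (WAlg.basis ϱ x) (actHom ϱ a b c h y u) =
      actHom ϱ a b c h (WAlg.bracketHom ϱ (WAlg.basis ϱ x) y) u + actHom ϱ a b c h y (actHom ϱ a b c h (WAlg.basis ϱ x) u)) y (fun y => ?_) (by simp)
    (fun s t ha hb => by simp only [map_add, LinearMap.add_apply, ha, hb]; abel)
    (fun d s ha => by simp only [map_smul, LinearMap.smul_apply, ha, smul_add])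
  suffices H : (actHom ϱ a b c h (WAlg.basis ϱ x)) ∘ₗ (actHom ϱ a b c h (WAlg.basis ϱ y)) =
      actHom ϱ a b c h (WAlg.bracketHom ϱ (WAlg.basis ϱ x) (WAlg.basis ϱ y)) +
      (actHom ϱ a b c h (WAlg.basis ϱ y)) ∘ₗ (actHom ϱ a b c h (WAlg.basis ϱ x)) from
    DFunLike.congr_fun H u
  refine (basis ϱ a b c h).ext fun i => ?_
  have key : ∀ {d e f : ℂ} {i j k : ℤ}, i = j → i = k → d = e + f →
      d • v ϱ a b c h i = e • v ϱ a b c h j + f • v ϱ a b c h k := by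
    rintro d e f i j k rfl rfl rfl
    exact add_smul _ _ _
  have key' : ∀ {d f : ℂ} {i k : ℤ}, i = k → d = f →
      d • v ϱ a b c h i = f • v ϱ a b c h k := by
    rintro d f i k rfl rfl
    rfl
  have hc : (ϱ : ℂ) * c = 0 := by rcases h with h | h <;> simp [h]
  rcases x with m | p <;> rcases y with n | q <;>
    simp only [← WAlg.L.eq_1, ← WAlg.Y.eq_1, ← v.eq_1, WAlg.bracketHom_LL, WAlg.bracketHom_LY,
      WAlg.bracketHom_YL, WAlg.bracketHom_YY, actHom_L_v, actHom_Y_v, LinearMap.comp_apply,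
      LinearMap.add_apply, map_smul, map_zero, LinearMap.smul_apply, smul_smul, ← neg_smul, zero_add]
  · refine key (by ring) (by ring) ?_
    push_cast
    ring
  · refine key (by ring) (by ring) ?_
    push_cast
    linear_combination (m : ℂ) * hc
  · refine key (by ring) (by ring) ?_
    push_cast
    linear_combination -(n : ℂ) * hc
  · refine key' (by ring) (by ring)

/-- The `W(ϱ)[0]`-module structure of `A_{a,b,c}`:
`L_m v_i = (a + i + b m) v_{m+i}` and `Y_p v_i = c v_{p+i}`. -/
instance : LieRingModule (WAlg ϱ) (IntermediateModule ϱ a b c h) where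
  bracket x u := actHom ϱ a b c h x u
  add_lie x y u := by simp
  lie_add x u w := by simp
  leibniz_lie x y u := actHom_leibniz ϱ a b c h x y u

instance : LieModule ℂ (WAlg ϱ) (IntermediateModule ϱ a b c h) where
  smul_lie t x u := by simp [Bracket.bracket]
  lie_smul t x u := by simp [Bracket.bracket]

theorem lie_L_v (m i : ℤ) : ⁅WAlg.L ϱ m, v ϱ a b c h i⁆ =
    (a + i + b * m) • v ϱ a b c h (m + i) :=
  actHom_L_v ϱ a b c h m i

theorem lie_Y_v (p i : ℤ) : ⁅WAlg.Y ϱ p, v ϱ a b c h i⁆ = c • v ϱ a b c h (p + i) :=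
  actHom_Y_v ϱ a b c h p i

end IntermediateModule

/-- The weight space `V^μ = {v ∈ V | L_0 v = μ v}`. -/
def weightSpace (ϱ : ℚ) (V : Type*) [AddCommGroup V] [Module ℂ V] [LieRingModule (WAlg ϱ) V]
    [LieModule ℂ (WAlg ϱ) V] (μ : ℂ) : Submodule ℂ V :=
  Module.End.eigenspace (LieModule.toEnd ℂ (WAlg ϱ) V (WAlg.L ϱ 0)) μ

/-- `V` is a weight module: it is the sum of its weight spaces. -/
def IsWeightModule (ϱ : ℚ) (V : Type*) [AddCommGroup V] [Module ℂ V] [LieRingModule (WAlg ϱ) V]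
    [LieModule ℂ (WAlg ϱ) V] : Prop :=
  ⨆ μ : ℂ, weightSpace ϱ V μ = ⊤

/-- All weight multiplicities of `V` are one: each weight space `V^μ` with `μ` in the support
of `V` is one-dimensional. -/
def HasMultiplicityOne (ϱ : ℚ) (V : Type*) [AddCommGroup V] [Module ℂ V]
    [LieRingModule (WAlg ϱ) V] [LieModule ℂ (WAlg ϱ) V] : Prop :=
  ∀ μ : ℂ, weightSpace ϱ V μ ≠ ⊥ → Module.finrank ℂ (weightSpace ϱ V μ) = 1

/-- `V` is isomorphic to a nontrivial simple subquotient `N / K` of the module `M`, where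
`K ⊆ N ⊆ M` are submodules. If `M` is irreducible, the only such subquotient is `M` itself. -/
def IsNontrivialSimpleSubquotient (ϱ : ℚ) (M V : Type*)
    [AddCommGroup M] [Module ℂ M] [LieRingModule (WAlg ϱ) M] [LieModule ℂ (WAlg ϱ) M]
    [AddCommGroup V] [Module ℂ V] [LieRingModule (WAlg ϱ) V] [LieModule ℂ (WAlg ϱ) V] : Prop :=
  ∃ (N : LieSubmodule ℂ (WAlg ϱ) M) (K : LieSubmodule ℂ (WAlg ϱ) N),
    LieModule.IsIrreducible ℂ (WAlg ϱ) (N ⧸ K) ∧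
    ¬ LieModule.IsTrivial (WAlg ϱ) (N ⧸ K) ∧
    Nonempty (V ≃ₗ⁅ℂ, WAlg ϱ⁆ (N ⧸ K))

end

/-! Since `ϱ` plays no role in `[L_0, Y_p] = p Y_p`, an irreducible weight module has its weights in
one coset `a + ℤ`. Choosing a spanning vector `e_i` of each weight space of weight `a + i` (zero off
the support `S`) turns the actions into scalars, `L_m e_i = f m i • e_{i+m}` and
`Y_p e_i = g p i • e_{i+p}`, with irreducibility saying that no proper nonempty subset of `S` is
closed under the moves with nonzero coefficient. It then suffices to find scalars `c_i`, nonzero on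
`S`, with `c_{i+m} f m i = (a + i + b m) c_i` and `c_{i+p} g p i = y c_i`: the map `e_i ↦ c_i v_i` is
an injective homomorphism of `V` into `A_{a,b,y}` (`IsWeightBasis.exists_lieModuleHom`).

*The action of the `Y_p`.* Products of total degree zero act by scalars on every weight space. If `D`
is such a product (`Y_0` or `Y_p Y_{-p}`) and `δ` is the difference of its values at `i` and `i + m`,
then `δ f m i` is the coefficient of `[L_m, D]`, while `δ` kills that coefficient because the `Y_p`
commute; so the square of the coefficient vanishes. For `ϱ ≠ 0` and `D = Y_0` this gives `Y_m = 0`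
for `m ≠ 0`, and `[L_m, Y_{-m}] = -m (1 + ϱ) Y_0` finishes when `ϱ ≠ -1`
(`CurrentCoeffs.eq_zero_of_ne`). For `ϱ = 0` it shows that `Y_p Y_{-p}` is a scalar and that
`Y_{p+m} Y_{-p} = Y_p Y_{m-p}`. If `Y_0 = 0` this forces all products `Y_p Y_q` to vanish, and then
`Y = 0` by irreducibility (`CurrentCoeffs.eq_zero_of_central_eq_zero`). If `Y_0 = y ≠ 0`, all `Y_p` are
invertible with `Y_p Y_q = y Y_{p+q}`; this provides the `c_i`, and the `L_m` are then determined by a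
cocycle equation (`CurrentCoeffs.exists_intertwiner_of_central_ne_zero`).

*The Witt algebra.* When `Y = 0`, the support is infinite, and the reflection `L_m ↦ -L_{-m}` allows
the assumption that it is unbounded above. The Casimir element of `⟨L_{-1}, L_0, L_1⟩` shows that `S`
contains a half-line, on which `L_{-1} L_1` acts by the quadratic `(x + b) (x + 1 - b)`, `x = a + i`.
The products `L_{-1}² L_2` and `L_1² L_{-2}` are cubics in `x` up to additive constants, and
`[L_2, L_{-2}] = -4 L_0` fixes these constants up to exchanging `b` and `1 - b`
(`WittCoeffs.exists_cubic`). So the half-line looks like `A_{a,b,0}`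
(`WittCoeffs.exists_isIntertwinerFrom`). For an arbitrary `j`, comparing `L_m L_{-k} e_{j+k}` with
`L_{-k} L_m e_{j+k}` for large `k` shows that `L_m e_j`, `m` large, is as in `A_{a,b,0}` up to one
scalar `c_j`; the only obstruction occurs at `a + j = 0`, `b = 1`, and irreducibility removes such `j`
from the support (`WittCoeffs.not_mem_of_add_eq_zero`). -/

/-! ### Weight modules of the Witt algebra in coordinates -/

/-- The scalars `f m i` describe an action `L_m e_i = f m i • e_{i+m}` of the Witt algebra on a space
with basis `e_i`, `i ∈ S`, on which `L_0` acts by `a + i`. For convenience `f` is defined for all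
`i : ℤ`, and is zero whenever the source `i` or the target `i + m` lies outside `S`; with this
convention the commutator relation `rel` holds without conditions on the indices. -/
structure WittCoeffs (S : Set ℤ) (a : ℂ) (f : ℤ → ℤ → ℂ) : Prop where
  source : ∀ {m i}, i ∉ S → f m i = 0
  target : ∀ {m i}, i + m ∉ S → f m i = 0
  zero : ∀ {i}, i ∈ S → f 0 i = a + i
  rel : ∀ m n i, f n i * f m (i + n) - f m i * f n (i + m) = ((n : ℂ) - m) * f (m + n) i

/-- No proper nonempty part of the support `S` is stable under the moves `i ↦ i + m` allowed by the
coefficients `f` and `g`: irreducibility of the module in coordinates. -/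
def CoeffIrreducible (S : Set ℤ) (f g : ℤ → ℤ → ℂ) : Prop :=
  ∀ T ⊆ S, T.Nonempty → (∀ i ∈ T, ∀ m, f m i ≠ 0 → i + m ∈ T) →
    (∀ i ∈ T, ∀ p, g p i ≠ 0 → i + p ∈ T) → T = S

namespace WittCoeffs

variable {S : Set ℤ} {a : ℂ} {f : ℤ → ℤ → ℂ}

/-- The commutator relation, with the indices free up to proved equalities. -/
theorem rel' (h : WittCoeffs S a f) (m n : ℤ) {i j k l : ℤ} (hj : j = i + n) (hk : k = i + m)
    (hl : l = m + n) : f n i * f m j - f m i * f n k = ((n : ℂ) - m) * f l i := by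
  subst hj hk hl
  exact h.rel m n i

/-- The coefficients of the module twisted by the automorphism `L_m ↦ -L_{-m}`. -/
theorem reflect (h : WittCoeffs S a f) :
    WittCoeffs {i | -i ∈ S} (-a) (fun m i => -f (-m) (-i)) where
  source hi := by simp [h.source (by simpa using hi)]
  target {m i} hi := by
    rw [h.target, neg_zero]
    simpa [add_comm] using hi
  zero {i} hi := by
    have := h.zero hi
    simp only [neg_zero, this]; push_cast; ring
  rel m n i := by
    have := h.rel' (-m) (-n) (i := -i) (j := -(i + n)) (k := -(i + m)) (l := -(m + n))
      (by ring) (by ring) (by ring)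
    push_cast at this
    linear_combination this

/-- A nontrivial module has infinite support: otherwise `L_m` and `L_{-m}` vanish for large `m`, hence
so does `[L_m, L_{-m}] = -2m L_0`. -/
theorem not_bounded (h : WittCoeffs S a f) (hnt : ∃ m i, f m i ≠ 0) (B : ℤ) :
    ∃ i ∈ S, B < |i| := by
  by_contra! hB
  obtain ⟨m, i, hmi⟩ := hnt
  have hS : ∀ i ∈ S, a + i = 0 := by
    intro i hi
    have hb := abs_le.mp (hB i hi)
    set k : ℤ := 2 * B + 1 with hk
    have h1 : f k i = 0 := h.target fun hm => by have := abs_le.mp (hB _ hm); omega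
    have h2 : f (-k) i = 0 := h.target fun hm => by have := abs_le.mp (hB _ hm); omega
    have := h.rel' k (-k) (i := i) (l := 0) rfl rfl (by ring)
    rw [h1, h2, h.zero hi] at this
    have hk0 : (k : ℂ) ≠ 0 := by
      norm_cast; have := abs_nonneg i; have := hB i hi; omega
    push_cast at this
    have h3 : (k : ℂ) * (a + i) = 0 := by linear_combination this / 2
    exact (mul_eq_zero.mp h3).resolve_left hk0
  have hi : i ∈ S := by by_contra hi; exact hmi (h.source hi)
  have him : i + m ∈ S := by by_contra hi; exact hmi (h.target hi)
  have h1 := hS _ hi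
  have h2 := hS _ him
  have hm : m = 0 := by
    push_cast at h2
    have : (m : ℂ) = 0 := by linear_combination h2 - h1
    exact_mod_cast this
  subst hm
  rw [h.zero hi] at hmi
  exact hmi h1

/-- The relation `[L_{-1}, L_1] = 2 L_0`, as a recursion for the scalar `L_{-1} L_1`. -/
theorem casimir (h : WittCoeffs S a f) {i : ℤ} (hi : i ∈ S) :
    f 1 i * f (-1) (i + 1) = f 1 (i - 1) * f (-1) i + 2 * (a + i) := by
  have := h.rel' (-1) 1 (i := i) (j := i + 1) (k := i - 1) (l := 0) rfl rfl (by norm_num)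
  rw [h.zero hi] at this
  push_cast at this
  linear_combination this

/-- Right after a gap of `S`, where `L_{-1} L_1` vanishes, the Casimir recursion keeps `L_{-1} L_1`
nonzero from weights of positive real part on, so no second gap can follow. -/
theorem exists_tail (h : WittCoeffs S a f) (hS : ∀ B, ∃ i ∈ S, B < i) :
    ∃ N, ∀ i ≥ N, i ∈ S := by
  obtain ⟨N, hN⟩ : ∃ N : ℤ, ∀ i ≥ N, 0 < (a + i).re := by
    obtain ⟨n, hn⟩ := exists_int_gt (-a.re)
    refine ⟨n, fun i hi => ?_⟩
    have : (n : ℝ) ≤ i := by exact_mod_cast hi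
    simp only [Complex.add_re, Complex.intCast_re]
    linarith
  by_cases hall : ∀ i ≥ N, i ∈ S
  · exact ⟨N, hall⟩
  push Not at hall
  obtain ⟨j, hjN, hj⟩ := hall
  obtain ⟨k, hkS, hk⟩ := hS j
  -- the least element of `S` beyond the gap `j`
  obtain ⟨q, ⟨hqS, hjq⟩, hq⟩ : ∃ q, (q ∈ S ∧ j < q) ∧ ∀ z, (z ∈ S ∧ j < z) → q ≤ z := by
    classical
    exact Int.exists_least_of_bdd (P := fun z => z ∈ S ∧ j < z) ⟨j, fun z hz => hz.2.le⟩
      ⟨k, hkS, hk⟩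
  have hq1 : q - 1 ∉ S := by
    intro hm
    rcases eq_or_lt_of_le (show j ≤ q - 1 by omega) with h1 | h1
    · exact hj (h1 ▸ hm)
    · have := hq _ ⟨hm, h1⟩; omega
  suffices H : ∀ i ≥ q, i ∈ S ∧ 0 < (f 1 i * f (-1) (i + 1)).re from ⟨q, fun i hi => (H i hi).1⟩
  intro i hi
  induction i, hi using Int.leInduction with
  | base =>
    refine ⟨hqS, ?_⟩
    rw [h.casimir hqS, h.source hq1]
    have := hN q (by omega)
    simp only [Complex.add_re, Complex.mul_re] at this ⊢
    norm_num at this ⊢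
    linarith
  | succ i hi ih =>
    have hmem : i + 1 ∈ S := by
      by_contra hm
      have := ih.2
      rw [h.target hm] at this
      simp at this
    refine ⟨hmem, ?_⟩
    rw [h.casimir hmem]
    have h1 := hN (i + 1) (by omega)
    have h2 := ih.2
    rw [add_sub_cancel_right]
    simp only [Complex.add_re] at h1 ⊢
    norm_num at h1 h2 ⊢
    linarith

theorem exists_quadratic (h : WittCoeffs S a f) (hS : ∀ B, ∃ i ∈ S, B < i) :
    ∃ N b, ∀ i ≥ N, i ∈ S ∧ f 1 i * f (-1) (i + 1) = (a + i + b) * (a + i + 1 - b) := by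
  obtain ⟨N, hN⟩ := h.exists_tail hS
  obtain ⟨z, hz⟩ := IsAlgClosed.exists_pow_nat_eq
    (1 - 4 * (f 1 N * f (-1) (N + 1) - (a + N) * (a + N + 1))) (n := 2) (by norm_num)
  refine ⟨N, (1 - z) / 2, fun i hi => ⟨hN i hi, ?_⟩⟩
  induction i, hi using Int.leInduction with
  | base => linear_combination hz / 4
  | succ i hi ih =>
    rw [h.casimir (hN _ (by omega)), add_sub_cancel_right, ih]
    push_cast
    ring

/-- The fourth difference of the identity shows `r = 0`, the third one then `D = -C`. -/
theorem eq_or_eq_of_identity {x b r C D : ℂ}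
    (h : ∀ k : ℕ, r * ((x + 2 * k - 1 + b) * (x + 2 * k - b) * (x + 2 * k - 2 + b) *
      (x + 2 * k - 1 - b)) =
      C * ((x + 2 * k - 2 * b) * (x + 2 * k - 1 + b) * (x + 2 * k - 2 + b)) +
      D * ((x + 2 * k - 2 + 2 * b) * (x + 2 * k - 1 - b) * (x + 2 * k - b)) + C * D) :
    C = 0 ∧ D = 0 ∨ C = -2 * b * (b - 1) * (2 * b - 1) ∧ D = 2 * b * (b - 1) * (2 * b - 1) := by
  have h0 := h 0
  have h1 := h 1
  have h2 := h 2
  have h3 := h 3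
  have h4 := h 4
  norm_num at h0 h1 h2 h3 h4
  have hr : r = 0 := by linear_combination (h0 - 4 * h1 + 6 * h2 - 4 * h3 + h4) / 384
  subst hr
  have hD : D = -C := by linear_combination (-h3 + 3 * h2 - 3 * h1 + h0) / 48
  subst hD
  have : C * (C + 2 * b * (b - 1) * (2 * b - 1)) = 0 := by linear_combination h0
  rcases mul_eq_zero.mp this with hC | hC
  · left; simp [hC]
  · exact Or.inr ⟨by linear_combination hC, by linear_combination -hC⟩

/-- The products `L_{-1}² L_2` and `L_1² L_{-2}` do not depend on the scaling of the basis. The first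
is known up to a constant `C` from `[L_{-1}, L_2] = 3 L_1`, the second up to a constant `D` from
`[L_1, L_{-2}] = -3 L_{-1}`. The nonzero solution for `(C, D)` is absorbed by replacing `b` by
`1 - b`, which leaves the quadratic `(x + b) (x + 1 - b)` unchanged. -/
theorem exists_cubic (h : WittCoeffs S a f) (hS : ∀ B, ∃ i ∈ S, B < i) :
    ∃ N b, ∀ i ≥ N, i ∈ S ∧ f 1 i * f (-1) (i + 1) = (a + i + b) * (a + i + 1 - b) ∧
      f 2 i * f (-1) (i + 2) * f (-1) (i + 1) =
        (a + i + 2 * b) * (a + i + 1 - b) * (a + i + 2 - b) ∧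
      f (-2) i * f 1 (i - 2) * f 1 (i - 1) =
        (a + i - 2 * b) * (a + i - 1 + b) * (a + i - 2 + b) := by
  obtain ⟨N, b, hN⟩ := h.exists_quadratic hS
  obtain ⟨C, hC⟩ : ∃ C, ∀ i ≥ N, f 2 i * f (-1) (i + 2) * f (-1) (i + 1) =
        (a + i + 2 * b) * (a + i + 1 - b) * (a + i + 2 - b) + C := by
    refine ⟨f 2 N * f (-1) (N + 2) * f (-1) (N + 1) -
      (a + N + 2 * b) * (a + N + 1 - b) * (a + N + 2 - b), fun i hi => ?_⟩
    induction i, hi using Int.leInduction with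
    | base => ring
    | succ i hi ih =>
      have h1 := h.rel' (-1) 2 (i := i + 1) (j := i + 1 + 2) (k := i) (l := 1) (by ring)
        (by ring) (by norm_num)
      have h2 := (hN (i + 1) (by omega)).2
      rw [show i + 2 = i + 1 + 1 by ring] at ih
      push_cast at h1 h2 ⊢
      linear_combination f (-1) (i + 1 + 1) * h1 + 3 * h2 + ih
  obtain ⟨D, hD⟩ : ∃ D, ∀ i ≥ N + 1, f (-2) i * f 1 (i - 2) * f 1 (i - 1) =
        (a + i - 2 * b) * (a + i - 1 + b) * (a + i - 2 + b) + D := by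
    refine ⟨f (-2) (N + 1) * f 1 (N + 1 - 2) * f 1 (N + 1 - 1) -
      (a + (N + 1 : ℤ) - 2 * b) * (a + (N + 1 : ℤ) - 1 + b) * (a + (N + 1 : ℤ) - 2 + b),
      fun i hi => ?_⟩
    induction i, hi using Int.leInduction with
    | base => ring
    | succ i hi ih =>
      have h1 := h.rel' 1 (-2) (i := i) (j := i - 2) (k := i + 1) (l := -1) (by ring)
        (by ring) (by norm_num)
      have h2 := (hN (i - 1) (by omega)).2
      rw [show i + 1 - 2 = i - 1 by ring, show i + 1 - 1 = i by ring]
      rw [show i - 1 + 1 = i by ring] at h2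
      push_cast at h1 h2 ih ⊢
      linear_combination ih - f 1 (i - 1) * h1 + 3 * h2
  -- along even steps, `L_2 L_{-2}` is a quadratic up to a constant, by `[L_2, L_{-2}] = -4 L_0`
  have hG : ∀ k : ℕ, f (-2) (N + 2 + 2 * k) * f 2 (N + 2 * k) =
      f (-2) (N + 2) * f 2 N - (a + N + 2 * b) * (a + N + 2 - 2 * b) +
      (a + N + 2 * k + 2 * b) * (a + N + 2 * k + 2 - 2 * b) := by
    intro k
    induction k with
    | zero => simp
    | succ k ih =>
      have h1 := h.rel' 2 (-2) (i := N + 2 + 2 * k) (j := N + 2 * k)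
        (k := N + 2 + 2 * (k + 1 : ℕ)) (l := 0) (by ring) (by push_cast; ring) (by norm_num)
      rw [h.zero (hN _ (by omega)).1] at h1
      rw [show N + 2 * ((k + 1 : ℕ) : ℤ) = N + 2 + 2 * k by push_cast; ring]
      push_cast at h1 ⊢
      linear_combination ih - h1
  have key := eq_or_eq_of_identity (x := a + N + 2) (b := b)
    (r := f (-2) (N + 2) * f 2 N - (a + N + 2 * b) * (a + N + 2 - 2 * b)) (C := C) (D := D) (by
      intro k
      have h1 := hC (N + 2 * k) (by omega)
      have h2 := hD (N + 2 * k + 2) (by omega)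
      have h3 := (hN (N + 2 * k) (by omega)).2
      have h4 := (hN (N + 2 * k + 1) (by omega)).2
      have h5 := hG k
      rw [show N + 2 * (k : ℤ) + 2 - 2 = N + 2 * k by ring,
        show N + 2 * (k : ℤ) + 2 - 1 = N + 2 * k + 1 by ring] at h2
      rw [show N + 2 * (k : ℤ) + 1 + 1 = N + 2 * k + 2 by ring] at h4
      rw [show N + 2 + 2 * (k : ℤ) = N + 2 * k + 2 by ring] at h5
      push_cast at h1 h2 h3 h4 h5
      -- both sides compute the product of the two cubic invariants
      have e1 := congrArg₂ (· * ·) h1 h2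
      have e2 := congrArg₂ (· * ·) h5 (congrArg₂ (· * ·) h3 h4)
      beta_reduce at e1 e2
      linear_combination e1 - e2)
  rcases key with ⟨rfl, rfl⟩ | ⟨rfl, rfl⟩
  · refine ⟨N + 1, b, fun i hi => ⟨(hN i (by omega)).1, (hN i (by omega)).2, ?_, ?_⟩⟩
    · rw [hC i (by omega), add_zero]
    · rw [hD i (by omega), add_zero]
  · refine ⟨N + 1, 1 - b, fun i hi => ⟨(hN i (by omega)).1, ?_, ?_, ?_⟩⟩
    · rw [(hN i (by omega)).2]; ring
    · rw [hC i (by omega)]; ring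
    · rw [hD i (by omega)]; ring

end WittCoeffs

/-! ### The action on a half-line of weights -/

theorem exists_forall_add_intCast_ne_zero (z : ℂ) : ∃ N : ℤ, ∀ i ≥ N, z + i ≠ 0 := by
  obtain ⟨n, hn⟩ := exists_int_gt (-z.re)
  refine ⟨n, fun i hi h0 => ?_⟩
  have h1 : (n : ℝ) ≤ i := by exact_mod_cast hi
  have h2 := congrArg Complex.re h0
  simp only [Complex.add_re, Complex.intCast_re, Complex.zero_re] at h2
  linarith

/-- Products of the ratios `r` give a nowhere vanishing solution of a first-order recursion. -/
theorem exists_rescaling (N : ℤ) (r : ℤ → ℂ) (hr : ∀ i ≥ N, r i ≠ 0) :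
    ∃ c : ℤ → ℂ, (∀ i, c i ≠ 0) ∧ ∀ i ≥ N, c (i + 1) = r i * c i := by
  refine ⟨fun i => ∏ t ∈ Finset.range (i - N).toNat, r (N + t), fun i => ?_, fun i hi => ?_⟩
  · exact Finset.prod_ne_zero_iff.mpr fun t _ => hr _ (by omega)
  · beta_reduce
    rw [show (i + 1 - N).toNat = (i - N).toNat + 1 by omega, Finset.prod_range_succ, mul_comm]
    congr 2
    omega

namespace WittCoeffs

variable {S : Set ℤ} {a : ℂ} {f : ℤ → ℤ → ℂ}

/-- The map `e_i ↦ c_i v_i` intertwines the Witt action with coefficients `f` and that of `A_{a,b,0}`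
as long as only indices `≥ N` are involved. -/
def IsIntertwinerFrom (a b : ℂ) (f : ℤ → ℤ → ℂ) (N : ℤ) (c : ℤ → ℂ) : Prop :=
  ∀ i ≥ N, ∀ m : ℤ, i + m ≥ N → c (i + m) * f m i = (a + i + b * m) * c i

/-- It suffices to check `L_{±1}` and `L_{±2}`: the other `L_{±(m+1)}` are multiples of
`[L_{±1}, L_{±m}]`, and all the intermediate indices stay `≥ N`. -/
theorem isIntertwinerFrom_of_generators (h : WittCoeffs S a f) {N : ℤ} {b : ℂ} {c : ℤ → ℂ}
    (hS : ∀ i ≥ N, i ∈ S)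
    (h1 : ∀ i ≥ N, c (i + 1) * f 1 i = (a + i + b) * c i)
    (h2 : ∀ i ≥ N, c (i + 2) * f 2 i = (a + i + b * 2) * c i)
    (h3 : ∀ i ≥ N, c i * f (-1) (i + 1) = (a + i + 1 - b) * c (i + 1))
    (h4 : ∀ i ≥ N, c i * f (-2) (i + 2) = (a + i + 2 - b * 2) * c (i + 2)) :
    IsIntertwinerFrom a b f N c := by
  have hpos : ∀ m : ℕ, ∀ i ≥ N, c (i + (m + 1)) * f (m + 1) i = (a + i + b * (m + 1)) * c i := by
    intro m
    induction m using Nat.strong_induction_on with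
    | _ m ih =>
      intro i hi
      match m with
      | 0 => simpa using h1 i hi
      | 1 => norm_num; exact h2 i hi
      | k + 2 =>
        have e1 := ih (k + 1) (by omega) i hi
        have e2 := ih (k + 1) (by omega) (i + 1) (by omega)
        have e3 := h1 (i + (k + 2)) (by omega)
        have e4 := h1 i hi
        have e5 := h.rel' 1 (k + 2) (i := i) (j := i + (k + 2)) (k := i + 1) (l := k + 3)
          rfl rfl (by ring)
        have hk : (k : ℂ) + 1 ≠ 0 := by exact_mod_cast Nat.succ_ne_zero k
        push_cast at e1 e2 e3 e4 e5 ⊢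
        rw [show (k : ℤ) + 1 + 1 = k + 2 by ring] at e1 e2
        rw [show i + 1 + ((k : ℤ) + 2) = i + (k + 3) by ring] at e2
        rw [show i + ((k : ℤ) + 2) + 1 = i + (k + 3) by ring] at e3
        rw [show (k : ℤ) + 2 + 1 = k + 3 by ring]
        apply mul_left_cancel₀ hk
        linear_combination (-c (i + (k + 3))) * e5 + f (k + 2) i * e3 - f 1 i * e2 +
          (a + i + (k + 2) + b) * e1 - (a + i + 1 + b * (k + 2)) * e4
  have hneg : ∀ m : ℕ, ∀ i ≥ N, c i * f (-(m + 1)) (i + (m + 1)) =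
      (a + i + (m + 1) - b * (m + 1)) * c (i + (m + 1)) := by
    intro m
    induction m using Nat.strong_induction_on with
    | _ m ih =>
      intro i hi
      match m with
      | 0 => simpa using h3 i hi
      | 1 => norm_num; exact h4 i hi
      | k + 2 =>
        have e1 := ih (k + 1) (by omega) (i + 1) (by omega)
        have e2 := ih (k + 1) (by omega) i hi
        have e3 := h3 i hi
        have e4 := h3 (i + (k + 2)) (by omega)
        have e5 := h.rel' (-1) (-(k + 2)) (i := i + (k + 3)) (j := i + 1) (k := i + (k + 2))
          (l := -(k + 3)) (by ring) (by ring) (by ring)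
        have hk : (k : ℂ) + 1 ≠ 0 := by exact_mod_cast Nat.succ_ne_zero k
        push_cast at e1 e2 e3 e4 e5 ⊢
        rw [show (k : ℤ) + 1 + 1 = k + 2 by ring] at e1 e2
        rw [show i + 1 + ((k : ℤ) + 2) = i + (k + 3) by ring] at e1
        rw [show i + ((k : ℤ) + 2) + 1 = i + (k + 3) by ring] at e4
        rw [show (k : ℤ) + 2 + 1 = k + 3 by ring]
        apply mul_left_cancel₀ hk
        linear_combination c i * e5 - f (-(k + 2)) (i + (k + 3)) * e3 +
          f (-1) (i + (k + 3)) * e2 - (a + i + 1 - b) * e1 +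
          (a + i + (k + 2) - b * (k + 2)) * e4
  intro i hi m hm
  rcases lt_trichotomy m 0 with hm0 | rfl | hm0
  · obtain ⟨k, rfl⟩ : ∃ k : ℕ, m = -(k + 1) := ⟨(-m - 1).toNat, by omega⟩
    have := hneg k (i + -(k + 1)) hm
    rw [show i + -((k : ℤ) + 1) + (k + 1) = i by ring] at this
    push_cast at this ⊢
    linear_combination this
  · simp [h.zero (hS i hi), mul_comm]
  · obtain ⟨k, rfl⟩ : ∃ k : ℕ, m = k + 1 := ⟨(m - 1).toNat, by omega⟩
    have := hpos k i hi
    push_cast at this ⊢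
    exact this

/-- On a half-line the module is of the form `A_{a,b,0}`. The parameter `b = 0` can be avoided, as
`A_{a,0,0}` and `A_{a,1,0}` agree where `a + i ≠ 0`. -/
theorem exists_isIntertwinerFrom (h : WittCoeffs S a f) (hS : ∀ B, ∃ i ∈ S, B < i) :
    ∃ N b c, b ≠ 0 ∧ (∀ i ≥ N, i ∈ S ∧ c i ≠ 0) ∧ IsIntertwinerFrom a b f N c := by
  obtain ⟨N₀, b, hN₀⟩ := h.exists_cubic hS
  obtain ⟨N₁, hN₁⟩ := exists_forall_add_intCast_ne_zero (a + b)
  obtain ⟨N₂, hN₂⟩ := exists_forall_add_intCast_ne_zero (a + 1 - b)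
  obtain ⟨N₃, hN₃⟩ := exists_forall_add_intCast_ne_zero a
  obtain ⟨N, h0, h1, h2, h3⟩ : ∃ N, N₀ ≤ N ∧ N₁ ≤ N ∧ N₂ ≤ N ∧ N₃ ≤ N :=
    ⟨max (max N₀ N₁) (max N₂ N₃), by simp⟩
  have hb : ∀ i ≥ N, a + i + b ≠ 0 := fun i hi => by
    convert hN₁ i (by omega) using 1; ring
  have hb' : ∀ i ≥ N, a + i + 1 - b ≠ 0 := fun i hi => by
    convert hN₂ i (by omega) using 1; ring
  have hf : ∀ i ≥ N, f 1 i ≠ 0 := fun i hi h0 => by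
    have := (hN₀ i (by omega)).2.1
    rw [h0, zero_mul] at this
    exact mul_ne_zero (hb i hi) (hb' i hi) this.symm
  obtain ⟨c, hc0, hc⟩ := exists_rescaling N (fun i => (a + i + b) / f 1 i)
    fun i hi => div_ne_zero (hb i hi) (hf i hi)
  have g1 : ∀ i ≥ N, c (i + 1) * f 1 i = (a + i + b) * c i := fun i hi => by
    rw [hc i hi]; have := hf i hi; field_simp
  have g3 : ∀ i ≥ N, c i * f (-1) (i + 1) = (a + i + 1 - b) * c (i + 1) := fun i hi => by
    apply mul_left_cancel₀ (hf i hi)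
    linear_combination c i * (hN₀ i (by omega)).2.1 - (a + i + 1 - b) * g1 i hi
  -- the recursion for `c` settles `L_1`, the quadratic `L_{-1}`, and the two cubics `L_{±2}`
  have main : IsIntertwinerFrom a b f N c := by
    refine h.isIntertwinerFrom_of_generators (fun i hi => (hN₀ i (by omega)).1) g1
      (fun i hi => ?_) g3 (fun i hi => ?_)
    · have e1 := (hN₀ i (by omega)).2.2.1
      have e2 := g3 i hi
      have e3 := g3 (i + 1) (by omega)
      have e4 := hb' (i + 1) (by omega)
      rw [show i + 1 + 1 = i + 2 by ring] at e3
      push_cast at e3 e4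
      apply mul_left_cancel₀ (mul_ne_zero (mul_ne_zero e4 (hb' i hi)) (hc0 (i + 1)))
      linear_combination c (i + 1) * c i * e1 - f 2 i * f (-1) (i + 2) * c (i + 1) * e2
        - f 2 i * (a + i + 1 - b) * c (i + 1) * e3
    · have e1 := (hN₀ (i + 2) (by omega)).2.2.2
      have e2 := g1 i hi
      have e3 := g1 (i + 1) (by omega)
      have e4 := hb (i + 1) (by omega)
      rw [show i + 1 + 1 = i + 2 by ring] at e3
      rw [show i + 2 - 2 = i by ring, show i + 2 - 1 = i + 1 by ring] at e1
      push_cast at e1 e3 e4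
      apply mul_left_cancel₀ (mul_ne_zero (mul_ne_zero e4 (hb i hi)) (hc0 (i + 1)))
      linear_combination c (i + 1) * c (i + 2) * e1 - f (-2) (i + 2) * f 1 (i + 1) * c (i + 2) * e2
        - f (-2) (i + 2) * (a + i + b) * c i * e3
  by_cases hbz : b = 0
  · -- multiplication by the weight turns `b = 0` into `b = 1`
    subst hbz
    refine ⟨N, 1, fun i => (a + i) * c i, one_ne_zero, fun i hi =>
      ⟨(hN₀ i (by omega)).1, mul_ne_zero (hN₃ i (by omega)) (hc0 i)⟩, fun i hi m hm => ?_⟩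
    have := main i hi m hm
    push_cast
    linear_combination (a + i + m) * this
  · exact ⟨N, b, c, hbz, fun i hi => ⟨(hN₀ i (by omega)).1, hc0 i⟩, main⟩

end WittCoeffs

/-! ### From the half-line to the whole module -/

theorem exists_le_add_mul_ne_zero (s : ℂ) {b : ℂ} (hb : b ≠ 0) (M : ℤ) :
    ∃ m ≥ M, s + b * m ≠ 0 := by
  obtain ⟨N, hN⟩ := exists_forall_add_intCast_ne_zero (s / b)
  refine ⟨max M N, le_max_left _ _, fun h0 => hN _ (le_max_right M N) ?_⟩
  field_simp
  linear_combination h0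

namespace WittCoeffs

variable {S : Set ℤ} {a : ℂ} {f : ℤ → ℤ → ℂ}

/-- For every `j`, far or not, the vectors `L_m e_j` with `m` large are those of a multiple of `v_j` in
`A_{a,b,0}`. This is read off from `[L_m, L_{-k}] e_{j+k}` with `j + k` on the half-line; the
coefficient of `L_{-k} e_{j+k}` is nonzero for some `k` unless `b = 1` and `a + j = 0`. -/
theorem exists_coeff_of_tail (h : WittCoeffs S a f) {N : ℤ} {b : ℂ} {c : ℤ → ℂ} (hb : b ≠ 0)
    (hc0 : ∀ i ≥ N, c i ≠ 0) (hc : IsIntertwinerFrom a b f N c) {j : ℤ}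
    (hj : ¬ (b = 1 ∧ a + j = 0)) :
    ∃ d, ∀ m, j + m ≥ N → c (j + m) * f m j = (a + j + b * m) * d := by
  obtain ⟨k, hk0, hkN, hk⟩ : ∃ k ≥ 0, j + k ≥ N ∧ a + j + k * (1 - b) ≠ 0 := by
    by_contra! H
    set k := max 0 (N - j)
    have h1 := H k (by omega) (by omega)
    have h2 := H (k + 1) (by omega) (by omega)
    push_cast at h2
    have h3 : b = 1 := by linear_combination h1 - h2
    subst h3
    exact hj ⟨rfl, by linear_combination h1⟩
  have key : ∀ m, j + m ≥ N → f (-k) (j + k) * (c (j + m) * f m j) =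
      (a + j + b * m) * (c (j + k) * (a + j + k * (1 - b))) := by
    intro m hm
    have e1 := h.rel' m (-k) (i := j + k) (j := j) (k := j + k + m) (l := -k + m) (by ring)
      (by ring) (by ring)
    have e2 := hc (j + k) hkN m (by omega)
    have e3 := hc (j + k) hkN (-k + m) (by omega)
    have e4 := hc (j + k + m) (by omega) (-k) (by omega)
    rw [show j + k + (-k + m) = j + m by ring] at e3
    rw [show j + k + m + -k = j + m by ring] at e4
    push_cast at e1 e2 e3 e4
    linear_combination c (j + m) * e1 + f m (j + k) * e4 + (a + j + k + m - b * k) * e2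
      - (k + m) * e3
  have hf : f (-k) (j + k) ≠ 0 := by
    obtain ⟨m, hm, hm0⟩ := exists_le_add_mul_ne_zero (a + j) hb (N - j)
    intro h0
    have := key m (by omega)
    rw [h0, zero_mul] at this
    exact mul_ne_zero hm0 (mul_ne_zero (hc0 _ hkN) hk) this.symm
  refine ⟨c (j + k) * (a + j + k * (1 - b)) / f (-k) (j + k), fun m hm => ?_⟩
  rw [← mul_div_assoc, eq_div_iff hf, mul_comm, key m hm]

/-- In `A_{a,1,0}` the vectors `v_i` with `a + i ≠ 0` span a submodule; accordingly an irreducible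
module of this shape has no vector of weight zero. If `e_j` had weight zero, it would be reached from
some other `e_i`, which makes `L_m e_j = 0` for all large `m`; the vectors with that property span a
submodule, which is proper. -/
theorem not_mem_of_add_eq_zero (h : WittCoeffs S a f) (hirr : CoeffIrreducible S f 0)
    {N : ℤ} {c : ℤ → ℂ} (hS : ∀ i ≥ N, i ∈ S)
    (hc0 : ∀ i ≥ N, c i ≠ 0) (hc : IsIntertwinerFrom a 1 f N c) {j : ℤ} (hj : a + j = 0) :
    j ∉ S := by
  intro hjS
  -- `[L_m, L_{j-i}] e_i`: if `e_j` is reached from `e_i`, then `L_m e_j = 0`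
  have hzero : ∀ i ≠ j, f (j - i) i ≠ 0 → ∀ m, j + m ≥ N → i + m ≥ N → f m j = 0 := by
    intro i hi hf m hjm him
    have hai : a + i ≠ 0 := fun h0 => hi (by
      have : (i : ℂ) = j := by linear_combination h0 - hj
      exact_mod_cast this)
    obtain ⟨d, hd⟩ := h.exists_coeff_of_tail one_ne_zero hc0 hc (j := i) fun H => hai H.2
    have e1 := h.rel' m (j - i) (i := i) (j := j) (k := i + m) (l := m + (j - i)) (by ring)
      (by ring) (by ring)
    have e2 := hd m him
    have e3 := hd (m + (j - i)) (by omega)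
    have e4 := hc (i + m) him (j - i) (by omega)
    rw [show i + (m + (j - i)) = j + m by ring] at e3
    rw [show i + m + (j - i) = j + m by ring] at e4
    push_cast at e1 e2 e3 e4
    have : f (j - i) i * (c (j + m) * f m j) = 0 := by
      linear_combination c (j + m) * e1 + f m i * e4 + (a + (i + m) + 1 * (j - i)) * e2
        + (j - i - m) * e3 + d * (a + j + m) * hj
    simpa [hf, hc0 _ hjm] using this
  set q := max N (j + 1) with hq
  have hqS : q ∈ S := hS _ (by omega)
  by_cases hex : ∃ i, i ≠ j ∧ f (j - i) i ≠ 0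
  · obtain ⟨i, hij, hfi⟩ := hex
    have hK := hirr {i | i ∈ S ∧ ∃ M, ∀ m ≥ M, f m i = 0} (fun i hi => hi.1)
      ⟨j, hjS, max (N - j) (N - i), fun m hm => hzero i hij hfi m (by omega) (by omega)⟩
      (fun i hi k hk => by
        obtain ⟨hiS, M, hM⟩ := hi
        refine ⟨by_contra fun hn => hk (h.target hn), max M (M - k), fun m hm => ?_⟩
        have := h.rel m k i
        rw [hM m (by omega), hM (m + k) (by omega)] at this
        simpa [hk] using this)
      (fun i hi p hp => absurd rfl hp)
    obtain ⟨-, M, hM⟩ := hK.symm ▸ hS N le_rfl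
    obtain ⟨m, hm, hm0⟩ := exists_le_add_mul_ne_zero (a + N) one_ne_zero (max M 0)
    have := hc N le_rfl m (by omega)
    rw [hM m (by omega), mul_zero] at this
    exact mul_ne_zero hm0 (hc0 N le_rfl) this.symm
  · push Not at hex
    have hT := hirr (S \ {j}) Set.sdiff_subset ⟨q, hqS, by simp; omega⟩
      (fun i hi m hm => ⟨by_contra fun hn => hm (h.target hn), fun hmj => hm (by
        have hm' : m = j - i := by simp at hmj; omega
        rw [hm']
        exact hex i (by simpa using hi.2))⟩)
      (fun i hi p hp => absurd rfl hp)
    have := hT.symm ▸ hjS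
    simp at this

theorem exists_intertwiner_of_unbounded (h : WittCoeffs S a f) (hirr : CoeffIrreducible S f 0)
    (hS : ∀ B, ∃ i ∈ S, B < i) :
    ∃ (b : ℂ) (c : ℤ → ℂ), (∀ i ∈ S, c i ≠ 0) ∧ ∀ i m : ℤ, c (i + m) * f m i = (a + i + b * m) * c i := by
  obtain ⟨N, b, c, hb, hN, hc⟩ := h.exists_isIntertwinerFrom hS
  have hd : ∀ j, ∃ d, ∀ m, j + m ≥ N → c (j + m) * f m j = (a + j + b * m) * d := by
    intro j
    by_cases hj : b = 1 ∧ a + j = 0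
    · obtain ⟨rfl, hj⟩ := hj
      have hjS := h.not_mem_of_add_eq_zero hirr (fun i hi => (hN i hi).1)
        (fun i hi => (hN i hi).2) hc hj
      exact ⟨0, fun m _ => by rw [h.source hjS]; ring⟩
    · exact h.exists_coeff_of_tail hb (fun i hi => (hN i hi).2) hc hj
  choose d hd using hd
  -- `L_k e_i` is tested against `L_m` with `m` large
  have hrel : ∀ i m : ℤ, d (i + m) * f m i = (a + i + b * m) * d i := by
    intro i k
    obtain ⟨m, hm, hm0⟩ := exists_le_add_mul_ne_zero (a + i + k) hb (max (N - i) (N - i - k))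
    have e1 := h.rel' m k (i := i) (j := i + k) (k := i + m) (l := k + m) rfl rfl (by ring)
    have e2 := hd i m (by omega)
    have e3 := hd i (k + m) (by omega)
    have e4 := hc (i + m) (by omega) k (by omega)
    have e5 := hd (i + k) m (by omega)
    rw [show i + (k + m) = i + k + m by ring] at e3
    rw [show i + m + k = i + k + m by ring] at e4
    push_cast at e1 e2 e3 e4 e5
    apply mul_left_cancel₀ hm0
    linear_combination c (i + k + m) * e1 - f k i * e5 + f m i * e4 +
      (a + (i + m) + b * k) * e2 + (k - m) * e3
  refine ⟨b, d, fun i hi h0 => ?_, hrel⟩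
  have hK := hirr {i | i ∈ S ∧ d i = 0} (fun i hi => hi.1) ⟨i, hi, h0⟩
    (fun i hi k hk => ⟨by_contra fun hn => hk (h.target hn), by
      have := hrel i k
      rw [hi.2, mul_zero] at this
      exact (mul_eq_zero.mp this).resolve_right hk⟩)
    (fun i hi p hp => absurd rfl hp)
  have hdN : d N = 0 := (hK.symm ▸ (hN N le_rfl).1 : N ∈ {i | i ∈ S ∧ d i = 0}).2
  obtain ⟨m, hm, hm0⟩ := exists_le_add_mul_ne_zero (a + N) hb 0
  have e1 := hd N m (by omega)
  rw [hc N le_rfl m (by omega), hdN, mul_zero] at e1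
  exact mul_ne_zero hm0 (hN N le_rfl).2 e1

/-- The classification of irreducible multiplicity-free weight modules of the Witt algebra, in
coordinates. -/
theorem exists_intertwiner (h : WittCoeffs S a f) (hirr : CoeffIrreducible S f 0)
    (hnt : ∃ m i, f m i ≠ 0) :
    ∃ (b : ℂ) (c : ℤ → ℂ), (∀ i ∈ S, c i ≠ 0) ∧ ∀ i m : ℤ, c (i + m) * f m i = (a + i + b * m) * c i := by
  by_cases hS : ∀ B, ∃ i ∈ S, B < i
  · exact h.exists_intertwiner_of_unbounded hirr hS
  push Not at hS
  obtain ⟨B, hB⟩ := hS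
  have hirr' : CoeffIrreducible {i | -i ∈ S} (fun m i => -f (-m) (-i)) 0 := by
    intro T hTS hT hf _
    have := hirr {i | -i ∈ T} (fun i hi => by simpa using hTS hi)
      (hT.imp' (fun i => -i) fun i hi => by simpa using hi)
      (fun i hi m hm => by
        have := hf (-i) hi (-m) (by simpa using hm)
        simpa [add_comm] using this)
      (fun i hi p hp => absurd rfl hp)
    rw [← this]
    simp
  obtain ⟨b, c, hc0, hc⟩ := h.reflect.exists_intertwiner_of_unbounded hirr' fun B' => by
    obtain ⟨i, hi, hiB⟩ := h.not_bounded hnt (max |B| |B'|)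
    have h1 := hB i hi
    have h2 := le_abs_self B
    have h3 := le_abs_self B'
    refine ⟨-i, by simpa using hi, ?_⟩
    rcases lt_abs.mp hiB with h4 | h4 <;> omega
  refine ⟨b, fun i => c (-i), fun i hi => hc0 _ (by simpa using hi), fun i m => ?_⟩
  have := hc (-i) (-m)
  simp only [neg_neg] at this
  beta_reduce
  rw [show -(i + m) = -i + -m by ring]
  push_cast at this
  linear_combination -this

end WittCoeffs

/-! ### The action of the abelian ideal -/

/-- The scalars `g p i` describe an action `Y_p e_i = g p i • e_{i+p}` of the ideal spanned by the
`Y_p`, compatible with the action of the Witt algebra given by `f`. As for `WittCoeffs`, `g` is zero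
when the source or the target lies outside the support. -/
structure CurrentCoeffs (ϱ : ℂ) (S : Set ℤ) (f g : ℤ → ℤ → ℂ) : Prop where
  source : ∀ {p i}, i ∉ S → g p i = 0
  target : ∀ {p i}, i + p ∉ S → g p i = 0
  relLY : ∀ m p i, g p i * f m (i + p) - f m i * g p (i + m) = ((p : ℂ) - m * ϱ) * g (m + p) i
  relYY : ∀ p q i, g q i * g p (i + q) = g p i * g q (i + p)

/-- Schur's lemma: an operator of degree zero commuting with the action is constant on the support. -/
theorem CoeffIrreducible.eq_of_invariant {S : Set ℤ} {f g : ℤ → ℤ → ℂ}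
    (hirr : CoeffIrreducible S f g) (hf : ∀ {m i}, i + m ∉ S → f m i = 0)
    (hg : ∀ {p i}, i + p ∉ S → g p i = 0) {σ : ℤ → ℂ}
    (hσf : ∀ m i, f m i * σ (i + m) = σ i * f m i) (hσg : ∀ p i, g p i * σ (i + p) = σ i * g p i)
    {i j : ℤ} (hi : i ∈ S) (hj : j ∈ S) : σ i = σ j := by
  have := hirr {k | k ∈ S ∧ σ k = σ j} (fun k hk => hk.1) ⟨j, hj, rfl⟩
    (fun k hk m hm => ⟨by_contra fun hn => hm (hf hn), mul_left_cancel₀ hm (by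
      rw [hσf, hk.2, mul_comm])⟩)
    (fun k hk m hm => ⟨by_contra fun hn => hm (hg hn), mul_left_cancel₀ hm (by
      rw [hσg, hk.2, mul_comm])⟩)
  exact (this.symm ▸ hi : i ∈ {k | k ∈ S ∧ σ k = σ j}).2

namespace CurrentCoeffs

variable {S : Set ℤ} {a ϱ : ℂ} {f g : ℤ → ℤ → ℂ}

theorem relLY' (h : CurrentCoeffs ϱ S f g) (m p : ℤ) {i j k l : ℤ} (hj : j = i + p)
    (hk : k = i + m) (hl : l = m + p) :
    g p i * f m j - f m i * g p k = ((p : ℂ) - m * ϱ) * g l i := by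
  subst hj hk hl
  exact h.relLY m p i

theorem relYY' (h : CurrentCoeffs ϱ S f g) (p q : ℤ) {i j k : ℤ} (hj : j = i + q)
    (hk : k = i + p) : g q i * g p j = g p i * g q k := by
  subst hj hk
  exact h.relYY p q i

/-- The scalar `Y_0` takes the same value at `i` and `i + m` if `g m i ≠ 0`, since `Y_0` and `Y_m`
commute; but `[L_m, Y_0] = -m ϱ Y_m` then says that `g m i = 0`. So only `Y_0` is left, and it is a
multiple of `[L_1, Y_{-1}]`. -/
theorem eq_zero_of_ne (h : CurrentCoeffs ϱ S f g) (h0 : ϱ ≠ 0) (h1 : ϱ ≠ -1) (p i : ℤ) :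
    g p i = 0 := by
  have hne : ∀ m ≠ 0, ∀ i, g m i = 0 := by
    intro m hm i
    have e1 := h.relLY' m 0 (i := i) (j := i) (k := i + m) (l := m) (by ring) rfl (by ring)
    have e2 := h.relYY' 0 m (i := i) (j := i + m) (k := i) rfl (by ring)
    have e3 : (m * ϱ * g m i) ^ 2 = 0 := by
      push_cast at e1
      linear_combination m * ϱ * g m i * e1 + m * ϱ * f m i * e2
    have hm' : (m : ℂ) ≠ 0 := by exact_mod_cast hm
    simpa [hm', h0] using e3
  by_cases hp : p = 0
  · subst hp
    have e1 := h.relLY' 1 (-1) (i := i) rfl rfl (l := 0) (by norm_num)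
    rw [hne (-1) (by norm_num), hne (-1) (by norm_num)] at e1
    push_cast at e1
    have : -(ϱ + 1) * g 0 i = 0 := by linear_combination -e1
    refine (mul_eq_zero.mp this).resolve_left fun h2 => h1 ?_
    linear_combination -h2
  · exact hne p hp i

/-- The scalar by which `Y_p Y_{-p}` acts on `e_i`. -/
def pairing (g : ℤ → ℤ → ℂ) (p i : ℤ) : ℂ := g (-p) i * g p (i - p)

theorem pairing_comm (h : CurrentCoeffs ϱ S f g) (p q i : ℤ) :
    g q i * pairing g p (i + q) = pairing g p i * g q i := by
  have e1 := h.relYY' (-p) q (i := i) (j := i + q) (k := i - p) rfl (by ring)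
  have e2 := h.relYY' p q (i := i - p) (j := i + q - p) (k := i) (by ring) (by ring)
  unfold pairing
  linear_combination g p (i + q - p) * e1 + g (-p) i * e2

theorem pairing_eq (h : CurrentCoeffs ϱ S f g) (p i : ℤ) :
    pairing g p i = g p i * g (-p) (i + p) :=
  h.relYY' p (-p) (by ring) (by ring)

/-- For `ϱ = 0`, the operator `Y_p Y_{-p}` commutes with every `L_m`, and the vanishing of
`[L_m, Y_p Y_{-p}] = p (Y_{p+m} Y_{-p} - Y_p Y_{m-p})` is a quadratic relation between the `Y_p`. -/
theorem mul_shift_eq (h : CurrentCoeffs 0 S f g) {p : ℤ} (hp : p ≠ 0) (m i : ℤ) :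
    g (-p) i * g (p + m) (i - p) = g (m - p) i * g p (i + m - p) ∧
      f m i * pairing g p (i + m) = pairing g p i * f m i := by
  have e1 := h.relLY' m (-p) (i := i) (j := i - p) (k := i + m) (l := m - p) (by ring) rfl
    (by ring)
  have e2 := h.relLY' m p (i := i - p) (j := i) (k := i + m - p) (l := p + m) (by ring) (by ring)
    (by ring)
  -- the difference `δ` of the values of `Y_p Y_{-p}` satisfies `δ f = p E` and `δ E = 0`, so
  -- `(p E)² = 0`
  have e3 : (pairing g p i - pairing g p (i + m)) * f m i =
      p * (g (-p) i * g (p + m) (i - p) - g (m - p) i * g p (i + m - p)) := by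
    push_cast at e1 e2
    unfold pairing
    linear_combination g (-p) i * e2 + g p (i + m - p) * e1
  have e4 : (pairing g p i - pairing g p (i + m)) *
      (g (-p) i * g (p + m) (i - p) - g (m - p) i * g p (i + m - p)) = 0 := by
    have c1 := h.pairing_comm p (p + m) (i - p)
    have c2 := h.pairing_comm p (-p) i
    have c3 := h.pairing_comm p p (i + m - p)
    have c4 := h.pairing_comm p (m - p) i
    rw [show i - p + (p + m) = i + m by ring] at c1
    rw [show i + -p = i - p by ring] at c2
    rw [show i + m - p + p = i + m by ring] at c3
    rw [show i + (m - p) = i + m - p by ring] at c4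
    linear_combination -(g (-p) i * c1) - g (p + m) (i - p) * c2 + g (m - p) i * c3
      + g p (i + m - p) * c4
  have hp' : (p : ℂ) ≠ 0 := by exact_mod_cast hp
  have e5 : p * (g (-p) i * g (p + m) (i - p) - g (m - p) i * g p (i + m - p)) = 0 := by
    rw [← sq_eq_zero_iff]
    linear_combination -(p * (g (-p) i * g (p + m) (i - p) - g (m - p) i * g p (i + m - p))) * e3
      + p * f m i * e4
  refine ⟨sub_eq_zero.mp ((mul_eq_zero.mp e5).resolve_left hp'), ?_⟩
  linear_combination -e3 - e5

/-- The Leibniz rule `[L_m, Y_p Y_q] = p Y_{m+p} Y_q + q Y_p Y_{m+q}`. -/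
theorem lie_mul (h : CurrentCoeffs 0 S f g) (m p q : ℤ) {i j k l n : ℤ} (hj : j = i + q)
    (hk : k = i + m) (hl : l = i + m + q) (hn : n = i + p + q) :
    g q i * g p j * f m n - f m i * (g q k * g p l) =
      p * (g q i * g (m + p) j) + q * (g (m + q) i * g p l) := by
  have e1 := h.relLY' m p (i := j) (j := n) (k := l) (l := m + p) (by omega) (by omega) rfl
  have e2 := h.relLY' m q (i := i) (j := j) (k := k) (l := m + q) hj hk rfl
  linear_combination g q i * e1 + g p l * e2

theorem pairing_eq_of_mem (h : CurrentCoeffs 0 S f g) (hW : WittCoeffs S a f)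
    (hirr : CoeffIrreducible S f g) {p : ℤ} (hp : p ≠ 0) {i j : ℤ} (hi : i ∈ S) (hj : j ∈ S) :
    pairing g p i = pairing g p j :=
  hirr.eq_of_invariant hW.target h.target (fun m i => (h.mul_shift_eq hp m i).2)
    (fun q i => h.pairing_comm p q i) hi hj

theorem central_eq_of_mem (h : CurrentCoeffs 0 S f g) (hW : WittCoeffs S a f)
    (hirr : CoeffIrreducible S f g) {i j : ℤ} (hi : i ∈ S) (hj : j ∈ S) : g 0 i = g 0 j :=
  hirr.eq_of_invariant hW.target h.target
    (fun m i => by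
      have := h.relLY' m 0 (i := i) (j := i) (k := i + m) (by ring) rfl rfl
      push_cast at this
      linear_combination -this)
    (fun q i => h.relYY' 0 q rfl (by ring)) hi hj

/-- If `Y_0 = 0`, then `Y_{2p} Y_{-p} = Y_p Y_0 = 0`, and brackets with suitable `L_m` give
`Y_{3p} Y_{-p} = 0`, `Y_p² = 0` and `Y_p Y_q = 0` in turn. Hence the common kernel of the `Y_p`, a
submodule, is everything. -/
theorem eq_zero_of_central_eq_zero (h : CurrentCoeffs 0 S f g) (hW : WittCoeffs S a f)
    (hirr : CoeffIrreducible S f g) (h0 : ∀ i, g 0 i = 0) (p i : ℤ) : g p i = 0 := by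
  have hmul : ∀ p q i, g p i * g q (i + p) = 0 := by
    intro p q i
    by_cases hp : p = 0
    · rw [hp, h0, zero_mul]
    have hp' : (p : ℂ) ≠ 0 := by exact_mod_cast hp
    have h2 : ∀ i, g (-p) i * g (2 * p) (i - p) = 0 := by
      intro i
      have := (h.mul_shift_eq hp p i).1
      rwa [sub_self, h0, zero_mul, ← two_mul] at this
    have h3 : ∀ i, g (-p) i * g (3 * p) (i - p) = 0 := by
      intro i
      have := h.lie_mul p (2 * p) (-p) (i := i) (j := i - p) (k := i + p) (l := i + p - p)
        (by ring) rfl (by ring) rfl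
      rw [h2, h2, show p + -p = 0 by ring, h0, show p + 2 * p = 3 * p by ring] at this
      push_cast at this
      have : (p : ℂ) * (g (-p) i * g (3 * p) (i - p)) = 0 := by linear_combination -this / 2
      exact (mul_eq_zero.mp this).resolve_left hp'
    have h4 : ∀ i, g p i * g p (i + p) = 0 := by
      intro i
      have := (h.mul_shift_eq hp (2 * p) i).1
      rw [show p + 2 * p = 3 * p by ring, h3, show 2 * p - p = p by ring,
        show i + 2 * p - p = i + p by ring] at this
      exact this.symm
    have := h.lie_mul (q - p) p p (i := i) (j := i + p) (k := i + (q - p)) (l := i + (q - p) + p)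
      rfl rfl rfl rfl
    rw [h4, h4, sub_add_cancel,
      h.relYY' p q (i := i) (j := i + (q - p) + p) (k := i + p) (by ring) rfl] at this
    have : (p : ℂ) * (g p i * g q (i + p)) = 0 := by linear_combination -this / 2
    exact (mul_eq_zero.mp this).resolve_left hp'
  by_contra hpi
  have hiS : i + p ∈ S := by
    by_contra hn
    exact hpi (h.target hn)
  have hT := hirr {j | j ∈ S ∧ ∀ q, g q j = 0} (fun j hj => hj.1)
    ⟨i + p, hiS, fun q => (mul_eq_zero.mp (hmul p q i)).resolve_left hpi⟩
    (fun j hj m hm => ⟨by_contra fun hn => hm (hW.target hn), fun q => by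
      have := h.relLY m q j
      rw [hj.2 q, hj.2 (m + q)] at this
      simpa [hm] using this⟩)
    (fun j hj q hq => absurd (hj.2 q) hq)
  have hi : i ∈ S := by
    by_contra hn
    exact hpi (h.source hn)
  exact hpi ((hT.symm ▸ hi : i ∈ {j | j ∈ S ∧ ∀ q, g q j = 0}).2 p)

/-- If `Y_p Y_{-p} = 0`, then `y Y_p² = Y_p (Y_p Y_0) = Y_p (Y_{2p} Y_{-p}) = 0`, and bracketing `Y_p² = 0`
twice with `L_{-p}` gives `Y_p = 0` and `Y_0 = 0`. -/
theorem ne_zero_of_central_ne_zero (h : CurrentCoeffs 0 S f g) (hW : WittCoeffs S a f)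
    (hirr : CoeffIrreducible S f g) {y : ℂ} (hy : y ≠ 0) (h0 : ∀ i ∈ S, g 0 i = y) (p : ℤ)
    {i : ℤ} (hi : i ∈ S) : pairing g p i ≠ 0 := by
  by_cases hp : p = 0
  · subst hp
    simp [pairing, h0 i hi, hy]
  have hp' : (p : ℂ) ≠ 0 := by exact_mod_cast hp
  intro hs
  have hs0 : ∀ j, pairing g p j = 0 := by
    intro j
    by_cases hj : j ∈ S
    · rw [h.pairing_eq_of_mem hW hirr hp hj hi, hs]
    · simp [pairing, h.source hj]
  have h2 : ∀ j, g p j * g p (j + p) = 0 := by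
    intro j
    by_cases hj : j ∈ S
    · by_contra hne
      have hjp : j + p ∈ S := by
        by_contra hn
        exact hne (by rw [h.target hn, zero_mul])
      have e1 := (h.mul_shift_eq hp p (j + p)).1
      have e2 := hs0 j
      rw [h.pairing_eq] at e2
      rw [sub_self, h0 _ hjp, show j + p + p - p = j + p by ring] at e1
      have : y * (g p j * g p (j + p)) = 0 := by
        linear_combination -(g p j) * e1 + g (p + p) (j + p - p) * e2
      exact hne ((mul_eq_zero.mp this).resolve_left hy)
    · rw [h.source hj, zero_mul]
  have h1 : ∀ j, g p j = 0 := by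
    intro j
    by_cases hj : j + p ∈ S
    · have := h.lie_mul (-p) p p (i := j) (j := j + p) (k := j - p) (l := j) rfl (by ring)
        (by ring) rfl
      have e1 := h2 (j - p)
      rw [sub_add_cancel] at e1
      rw [h2, e1, show -p + p = 0 by ring, h0 _ hj] at this
      by_cases hj' : j ∈ S
      · rw [h0 _ hj'] at this
        have : p * y * g p j = 0 := by linear_combination -this / 2
        simpa [hp', hy] using this
      · exact h.source hj'
    · exact h.target hj
  have := h.relLY' (-p) p (i := i) rfl rfl (l := 0) (by ring)
  rw [h1, h1, h0 i hi] at this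
  have : (p : ℂ) * y = 0 := by linear_combination -this
  exact mul_ne_zero hp' hy this

/-- With `σ = Y_p Y_{-p}`, the relations `σ Y_{2p} = y Y_p²` and `σ Y_{3p} = Y_p³` together with
`[L_p, Y_{2p}] = 2p Y_{3p}` force `σ = y²`; bracketing `y Y_{2p} = Y_p²` with `L_{q-p}` gives the
claim. -/
theorem mul_eq_central_mul (h : CurrentCoeffs 0 S f g) (hW : WittCoeffs S a f)
    (hirr : CoeffIrreducible S f g) {y : ℂ} (hy : y ≠ 0) (h0 : ∀ i, g 0 i = y) (p q i : ℤ) :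
    g p i * g q (i + p) = y * g (p + q) i := by
  have hS : ∀ i, i ∈ S := fun i => by
    by_contra hn
    exact hy (by rw [← h0 i, h.source hn])
  by_cases hp : p = 0
  · subst hp
    rw [h0, add_zero, zero_add]
  have hp' : (p : ℂ) ≠ 0 := by exact_mod_cast hp
  obtain ⟨σ, hσ⟩ : ∃ σ, ∀ i, pairing g p i = σ :=
    ⟨_, fun i => h.pairing_eq_of_mem hW hirr hp (hS i) (hS 0)⟩
  have hne : ∀ p i, g p i ≠ 0 := fun p i hn =>
    h.ne_zero_of_central_ne_zero hW hirr hy (fun i _ => h0 i) p (hS i) (by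
      rw [h.pairing_eq, hn, zero_mul])
  have h2 : ∀ i, σ * g (2 * p) i = y * (g p i * g p (i + p)) := by
    intro i
    have e1 := (h.mul_shift_eq hp p (i + p)).1
    rw [sub_self, h0, add_sub_cancel_right, add_sub_cancel_right, ← two_mul] at e1
    rw [← hσ i, h.pairing_eq]
    linear_combination g p i * e1
  have h3 : ∀ i, σ * g (3 * p) i = g p i * g p (i + p) * g p (i + 2 * p) := by
    intro i
    have e1 := (h.mul_shift_eq hp (2 * p) (i + p)).1
    rw [show p + 2 * p = 3 * p by ring, show 2 * p - p = p by ring, add_sub_cancel_right,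
      show i + p + 2 * p - p = i + 2 * p by ring] at e1
    rw [← hσ i, h.pairing_eq]
    linear_combination g p i * e1
  have hlie : ∀ m i, σ * g (2 * p + m) i = y * (g p i * g (p + m) (i + p)) := by
    intro m i
    have e1 := h.lie_mul m p p (i := i) (j := i + p) (k := i + m) (l := i + m + p)
      (n := i + 2 * p) rfl rfl rfl (by ring)
    have e2 := h.relLY' m (2 * p) (i := i) (j := i + 2 * p) (k := i + m) (l := 2 * p + m) rfl rfl
      (by ring)
    have e3 := h.relYY' p (m + p) (i := i) (j := i + m + p) (k := i + p) (by ring) rfl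
    push_cast at e2
    rw [show p + m = m + p by ring]
    apply mul_left_cancel₀ hp'
    linear_combination (y / 2) * e1 - (σ / 2) * e2 + (f m (i + 2 * p) / 2) * h2 i
      - (f m i / 2) * h2 (i + m) + (p * y / 2) * e3
  have hσy : σ = y ^ 2 := by
    have e1 := hlie p 0
    have e2 := h2 0
    have e3 := h3 0
    have e4 := h.relYY' p (2 * p) (i := 0) (j := 0 + 2 * p) (k := 0 + p) rfl rfl
    rw [show 2 * p + p = 3 * p by ring, show p + p = 2 * p by ring] at e1
    have hσ0 : σ ≠ 0 := by
      rw [← hσ 0]; exact h.ne_zero_of_central_ne_zero hW hirr hy (fun i _ => h0 i) p (hS 0)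
    apply mul_right_cancel₀ (mul_ne_zero hσ0 (hne (3 * p) 0))
    linear_combination σ * e1 - σ * y * e4 + y * g p (0 + 2 * p) * e2 - y ^ 2 * e3
  have e1 := hlie (q - p) i
  rw [hσy, show 2 * p + (q - p) = p + q by ring, show p + (q - p) = q by ring] at e1
  apply mul_left_cancel₀ hy
  linear_combination -e1

/-- The recursion leaves `F 0`, `F 1`, `F 2` free; the pair `(-1, 2)` ties `F 2` to the other two. -/
theorem eq_affine_of_cocycle {F : ℤ → ℂ}
    (hF : ∀ m n : ℤ, n * F n - m * F m = (n - m) * F (m + n)) (m : ℤ) :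
    F m = F 0 + (F 1 - F 0) * m := by
  have hneg : ∀ m, F (-m) = 2 * F 0 - F m := by
    intro m
    by_cases hm : m = 0
    · subst hm; norm_num; ring
    have hm' : (m : ℂ) ≠ 0 := by exact_mod_cast hm
    have := hF m (-m)
    rw [add_neg_cancel] at this
    push_cast at this
    apply mul_left_cancel₀ hm'
    linear_combination -this
  have h2 : F 2 = F 0 + (F 1 - F 0) * 2 := by
    have e1 := hF (-1) 2
    have e2 := hneg 1
    norm_num at e1 e2
    linear_combination (e1 - e2) / 2
  have hpos : ∀ n : ℕ, F n = F 0 + (F 1 - F 0) * n := by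
    intro n
    match n with
    | 0 => simp
    | 1 => simp
    | k + 2 =>
      induction k with
      | zero => simpa using h2
      | succ k ih =>
        have e1 := hF 1 (k + 2)
        have hk : (k : ℂ) + 1 ≠ 0 := by exact_mod_cast Nat.succ_ne_zero k
        rw [show (1 : ℤ) + (k + 2) = k + 1 + 2 by ring] at e1
        push_cast at e1 ih ⊢
        apply mul_left_cancel₀ hk
        linear_combination -e1 + (k + 2) * ih
  obtain ⟨n, rfl | rfl⟩ := m.eq_nat_or_neg
  · exact_mod_cast hpos n
  · rw [hneg, hpos]
    push_cast
    ring

/-- When `Y_0 = y ≠ 0`, the choice `c_i = y / g i 0` makes every `Y_p` act as in `A_{a,b,y}`. Then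
`[L_m, Y_p] = p Y_{m+p}` says that the rescaled coefficient of `L_m` at `i` is `i` plus a function of
`m`, which the Witt relations make affine. -/
theorem exists_intertwiner_of_central_ne_zero (h : CurrentCoeffs 0 S f g)
    (hW : WittCoeffs S a f) (hirr : CoeffIrreducible S f g) (hS : S.Nonempty) {y : ℂ}
    (hy : y ≠ 0) (h0 : ∀ i ∈ S, g 0 i = y) :
    ∃ (b : ℂ) (c : ℤ → ℂ), (∀ i ∈ S, c i ≠ 0) ∧
      (∀ i m : ℤ, c (i + m) * f m i = (a + i + b * m) * c i) ∧
      ∀ i p : ℤ, c (i + p) * g p i = y * c i := by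
  have hne' : ∀ p, ∀ i ∈ S, g p i ≠ 0 := fun p i hi hn =>
    h.ne_zero_of_central_ne_zero hW hirr hy h0 p hi (by rw [h.pairing_eq, hn, zero_mul])
  have hmem : ∀ i, i ∈ S := fun i => by
    obtain ⟨j, hj⟩ := hS
    by_contra hn
    exact hne' (i - j) j hj (h.target (by simpa using hn))
  have hne : ∀ p i, g p i ≠ 0 := fun p i => hne' p i (hmem i)
  have hmul := h.mul_eq_central_mul hW hirr hy fun i => h0 i (hmem i)
  set c : ℤ → ℂ := fun i => y / g i 0 with hc
  have hcg : ∀ i, c i * g i 0 = y := fun i => div_mul_cancel₀ _ (hne i 0)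
  have hc0 : ∀ i, c i ≠ 0 := fun i => div_ne_zero hy (hne i 0)
  have hYc : ∀ i p : ℤ, c (i + p) * g p i = y * c i := by
    intro i p
    have e1 := hmul i p 0
    rw [zero_add] at e1
    apply mul_right_cancel₀ (hne i 0)
    linear_combination c (i + p) * e1 + y * hcg (i + p) - y * hcg i
  have hLc : ∀ i m : ℤ, c (i + m) * f m i = (c m * f m 0 + i) * c i := by
    intro i m
    have e1 := h.relLY' m i (i := 0) (j := i) (k := m) (l := i + m) (by ring) (by ring) (by ring)
    have e2 := hYc m i
    rw [add_comm m i] at e2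
    apply mul_right_cancel₀ (hne i 0)
    linear_combination c (i + m) * e1 + f m 0 * e2 + i * hcg (i + m)
      - (c m * f m 0 + i) * hcg i
  have hc1 : c 0 = 1 := by rw [hc]; exact (congrArg (y / ·) (h0 0 (hmem 0))).trans (div_self hy)
  have hF := eq_affine_of_cocycle (F := fun m => c m * f m 0) (fun m n => by
    have e1 := hW.rel' m n (i := 0) (j := n) (k := m) (l := m + n) (by ring) (by ring) rfl
    have e2 := hLc n m
    have e3 := hLc m n
    rw [add_comm n m] at e2
    linear_combination c (m + n) * e1 - f n 0 * e2 + f m 0 * e3)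
  have hF0 : c 0 * f 0 0 = a := by rw [hc1, hW.zero (hmem 0)]; simp
  refine ⟨c 1 * f 1 0 - a, c, fun i _ => hc0 i, fun i m => ?_, hYc⟩
  have := hF m
  beta_reduce at this
  rw [hLc, this, hF0]
  ring

end CurrentCoeffs

/-! ### Coordinates on an irreducible weight module -/

section Modules

open WAlg

variable {ϱ : ℚ} {V : Type*} [AddCommGroup V] [Module ℂ V] [LieRingModule (WAlg ϱ) V]
  [LieModule ℂ (WAlg ϱ) V]

theorem lie_mem_of_generators {N : Submodule ℂ V} {v : V} (hL : ∀ m, ⁅L ϱ m, v⁆ ∈ N)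
    (hY : ∀ p, ⁅Y ϱ p, v⁆ ∈ N) (x : WAlg ϱ) : ⁅x, v⁆ ∈ N := by
  refine induction_basis ϱ (P := fun x => ⁅x, v⁆ ∈ N) x ?_ (by simp)
    (fun s t hs ht => by rw [add_lie]; exact N.add_mem hs ht)
    (fun d s hs => by rw [smul_lie]; exact N.smul_mem d hs)
  rintro (m | p)
  · exact hL m
  · exact hY p

/-- Irreducibility, for subspaces stable under the generators. -/
theorem eq_bot_or_eq_top_of_stable (hirr : LieModule.IsIrreducible ℂ (WAlg ϱ) V)
    (N : Submodule ℂ V) (hL : ∀ m, ∀ v ∈ N, ⁅L ϱ m, v⁆ ∈ N) (hY : ∀ p, ∀ v ∈ N, ⁅Y ϱ p, v⁆ ∈ N) :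
    N = ⊥ ∨ N = ⊤ := by
  let N' : LieSubmodule ℂ (WAlg ϱ) V :=
    { N with lie_mem := fun {x v} hv => lie_mem_of_generators (hL · v hv) (hY · v hv) x }
  rcases hirr.eq_bot_or_eq_top N' with h | h
  · left
    rw [← LieSubmodule.toSubmodule_eq_bot] at h
    exact h
  · right
    rw [← LieSubmodule.toSubmodule_eq_top] at h
    exact h

theorem mem_weightSpace {μ : ℂ} {v : V} : v ∈ weightSpace ϱ V μ ↔ ⁅L ϱ 0, v⁆ = μ • v := by
  simp [weightSpace]

theorem L_lie_mem_weightSpace {μ : ℂ} {v : V} (hv : v ∈ weightSpace ϱ V μ) (m : ℤ) :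
    ⁅L ϱ m, v⁆ ∈ weightSpace ϱ V (μ + m) := by
  rw [mem_weightSpace] at hv ⊢
  rw [leibniz_lie, lie_L_L, hv, smul_lie, lie_smul, zero_add, ← add_smul]
  push_cast
  congr 1
  ring

theorem Y_lie_mem_weightSpace {μ : ℂ} {v : V} (hv : v ∈ weightSpace ϱ V μ) (p : ℤ) :
    ⁅Y ϱ p, v⁆ ∈ weightSpace ϱ V (μ + p) := by
  rw [mem_weightSpace] at hv ⊢
  rw [leibniz_lie, lie_L_Y, hv, smul_lie, lie_smul, zero_add, ← add_smul]
  push_cast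
  congr 1
  ring

theorem exists_iSup_weightSpace_eq_top (hirr : LieModule.IsIrreducible ℂ (WAlg ϱ) V)
    (hweight : IsWeightModule ϱ V) : ∃ a : ℂ, ⨆ i : ℤ, weightSpace ϱ V (a + i) = ⊤ := by
  have := LieModule.nontrivial_of_isIrreducible ℂ (WAlg ϱ) V
  obtain ⟨a, ha⟩ : ∃ a, weightSpace ϱ V a ≠ ⊥ := by
    by_contra! h
    have h2 : ⨆ μ : ℂ, weightSpace ϱ V μ = ⊤ := hweight
    simp only [h, iSup_bot] at h2
    exact bot_ne_top h2
  refine ⟨a, (eq_bot_or_eq_top_of_stable hirr _ (fun m v hv => ?_)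
    (fun p v hv => ?_)).resolve_left fun h => ha ?_⟩
  · induction hv using Submodule.iSup_induction' with
    | mem i x hx =>
      refine Submodule.mem_iSup_of_mem (i + m) ?_
      have := L_lie_mem_weightSpace hx m
      rwa [add_assoc, ← Int.cast_add] at this
    | zero => rw [lie_zero]; exact Submodule.zero_mem _
    | add x y _ _ hx hy => rw [lie_add]; exact Submodule.add_mem _ hx hy
  · induction hv using Submodule.iSup_induction' with
    | mem i x hx =>
      refine Submodule.mem_iSup_of_mem (i + p) ?_
      have := Y_lie_mem_weightSpace hx p
      rwa [add_assoc, ← Int.cast_add] at this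
    | zero => rw [lie_zero]; exact Submodule.zero_mem _
    | add x y _ _ hx hy => rw [lie_add]; exact Submodule.add_mem _ hx hy
  · rw [iSup_eq_bot] at h
    simpa using h 0

theorem exists_spanning_vector (hmult : HasMultiplicityOne ϱ V) (μ : ℂ) :
    ∃ e ∈ weightSpace ϱ V μ, ∀ v ∈ weightSpace ϱ V μ, ∃ r : ℂ, v = r • e := by
  by_cases h : weightSpace ϱ V μ = ⊥
  · exact ⟨0, Submodule.zero_mem _, fun v hv => ⟨0, by simpa [h] using hv⟩⟩
  · obtain ⟨e, -, he⟩ := finrank_eq_one_iff'.mp (hmult μ h)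
    refine ⟨e, e.2, fun v hv => ?_⟩
    obtain ⟨r, hr⟩ := he ⟨v, hv⟩
    exact ⟨r, congrArg Subtype.val hr.symm⟩

variable (ϱ) in
/-- A family `e` of vectors of weights `a + i`, whose nonzero members form a basis of `V`, together with
the coefficients `f`, `g` of the actions of `L_m` and `Y_p`. The vectors `e i` outside the support are
zero. -/
structure IsWeightBasis (a : ℂ) (e : ℤ → V) (f g : ℤ → ℤ → ℂ) : Prop where
  span_eq_top : ⊤ ≤ Submodule.span ℂ (Set.range fun i : {i | e i ≠ 0} => e i)
  linearIndependent : LinearIndependent ℂ fun i : {i | e i ≠ 0} => e i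
  lie_L : ∀ m i, ⁅L ϱ m, e i⁆ = f m i • e (i + m)
  lie_Y : ∀ p i, ⁅Y ϱ p, e i⁆ = g p i • e (i + p)
  witt : WittCoeffs {i | e i ≠ 0} a f
  current : CurrentCoeffs ϱ {i | e i ≠ 0} f g

/-- Coordinates exist: each weight space of weight `a + i` is spanned by one, possibly zero, vector,
and eigenvectors of `L_0` for different eigenvalues are independent. -/
theorem exists_isWeightBasis (hirr : LieModule.IsIrreducible ℂ (WAlg ϱ) V)
    (hweight : IsWeightModule ϱ V) (hmult : HasMultiplicityOne ϱ V) :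
    ∃ (a : ℂ) (e : ℤ → V) (f g : ℤ → ℤ → ℂ), IsWeightBasis ϱ a e f g := by
  obtain ⟨a, ha⟩ := exists_iSup_weightSpace_eq_top hirr hweight
  choose e he hspan using fun i : ℤ => exists_spanning_vector hmult (a + i)
  -- coefficients are not unique where `e (i + m) = 0`; they are chosen to be zero there
  have hcoeff : ∀ (i m : ℤ) (v : V), v ∈ weightSpace ϱ V (a + i + m) →
      (e i = 0 → v = 0) → ∃ r : ℂ, v = r • e (i + m) ∧ (e i = 0 → r = 0) ∧
        (e (i + m) = 0 → r = 0) := by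
    intro i m v hv hv0
    by_cases h : e i = 0 ∨ e (i + m) = 0
    · refine ⟨0, ?_, fun _ => rfl, fun _ => rfl⟩
      rw [add_assoc, ← Int.cast_add] at hv
      obtain ⟨r, hr⟩ := hspan _ v hv
      rcases h with h | h
      · rw [hv0 h, zero_smul]
      · rw [hr, h, smul_zero, smul_zero]
    · push Not at h
      rw [add_assoc, ← Int.cast_add] at hv
      obtain ⟨r, hr⟩ := hspan _ v hv
      exact ⟨r, hr, fun h0 => absurd h0 h.1, fun h0 => absurd h0 h.2⟩
  choose f hf hf1 hf2 using fun m i => hcoeff i m ⁅L ϱ m, e i⁆ (L_lie_mem_weightSpace (he i) m)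
    (fun h => by rw [h, lie_zero])
  choose g hg hg1 hg2 using fun p i => hcoeff i p ⁅Y ϱ p, e i⁆ (Y_lie_mem_weightSpace (he i) p)
    (fun h => by rw [h, lie_zero])
  refine ⟨a, e, f, g, ?_, ?_, hf, hg, ⟨?_, ?_, ?_, ?_⟩, ⟨?_, ?_, ?_, ?_⟩⟩
  · rw [← ha, iSup_le_iff]
    intro i v hv
    obtain ⟨r, rfl⟩ := hspan i v hv
    refine Submodule.smul_mem _ _ ?_
    by_cases h : e i = 0
    · rw [h]; exact Submodule.zero_mem _
    · exact Submodule.subset_span ⟨⟨i, h⟩, rfl⟩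
  · refine Module.End.eigenvectors_linearIndependent' (LieModule.toEnd ℂ (WAlg ϱ) V (L ϱ 0))
      (fun i : {i | e i ≠ 0} => a + (i : ℤ)) (fun i j hij => ?_) _ fun i => ⟨he i, i.2⟩
    have : ((i : ℤ) : ℂ) = (j : ℤ) := add_left_cancel hij
    exact Subtype.ext (by exact_mod_cast this)
  · exact fun {m i} hi => hf1 m i (not_not.mp hi)
  · exact fun {m i} hi => hf2 m i (not_not.mp hi)
  · intro i hi
    have h1 := hf 0 i
    rw [mem_weightSpace.mp (he i), add_zero] at h1
    exact (smul_left_injective ℂ hi h1).symm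
  · intro m n i
    by_cases h0 : e (i + (m + n)) = 0
    · rw [hf2 (m + n) i h0, hf2 m (i + n) (by rwa [add_assoc, add_comm n m]),
        hf2 n (i + m) (by rwa [add_assoc])]
      ring
    · have h1 := leibniz_lie (L ϱ m) (L ϱ n) (e i)
      rw [lie_L_L, smul_lie, hf, hf, hf, lie_smul, lie_smul, hf, hf, add_assoc i n m, add_comm n m,
        add_assoc i m n, smul_smul, smul_smul, smul_smul, ← add_smul] at h1
      linear_combination smul_left_injective ℂ h0 h1
  · exact fun {m i} hi => hg1 m i (not_not.mp hi)
  · exact fun {m i} hi => hg2 m i (not_not.mp hi)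
  · intro m p i
    by_cases h0 : e (i + (m + p)) = 0
    · rw [hg2 (m + p) i h0, hf2 m (i + p) (by rwa [add_assoc, add_comm p m]),
        hg2 p (i + m) (by rwa [add_assoc])]
      ring
    · have h1 := leibniz_lie (L ϱ m) (Y ϱ p) (e i)
      rw [lie_L_Y, smul_lie, hf, hg, hg, lie_smul, lie_smul, hf, hg, add_assoc i p m, add_comm p m,
        add_assoc i m p, smul_smul, smul_smul, smul_smul, ← add_smul] at h1
      linear_combination smul_left_injective ℂ h0 h1
  · intro p q i
    by_cases h0 : e (i + (p + q)) = 0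
    · rw [hg2 p (i + q) (by rwa [add_assoc, add_comm q p]), hg2 q (i + p) (by rwa [add_assoc])]
      ring
    · have h1 := leibniz_lie (Y ϱ p) (Y ϱ q) (e i)
      rw [lie_Y_Y, zero_lie, zero_add, hg, hg, lie_smul, lie_smul, hg, hg, add_assoc i q p,
        add_comm q p, add_assoc i p q, smul_smul, smul_smul] at h1
      exact smul_left_injective ℂ h0 h1

namespace IsWeightBasis

variable {a : ℂ} {e : ℤ → V} {f g : ℤ → ℤ → ℂ}

theorem coeffIrreducible (h : IsWeightBasis ϱ a e f g)
    (hirr : LieModule.IsIrreducible ℂ (WAlg ϱ) V) : CoeffIrreducible {i | e i ≠ 0} f g := by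
  intro T hTS hT hf hg
  have key : ∀ (x : ℤ → WAlg ϱ) (k : ℤ → ℤ → ℂ), (∀ m i, ⁅x m, e i⁆ = k m i • e (i + m)) →
      (∀ i ∈ T, ∀ m, k m i ≠ 0 → i + m ∈ T) → ∀ m, ∀ v ∈ Submodule.span ℂ (e '' T),
        ⁅x m, v⁆ ∈ Submodule.span ℂ (e '' T) := by
    intro x k hx hk m v hv
    induction hv using Submodule.span_induction with
    | mem v hv =>
      obtain ⟨i, hi, rfl⟩ := hv
      rw [hx]
      by_cases h0 : k m i = 0
      · rw [h0, zero_smul]; exact Submodule.zero_mem _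
      · exact Submodule.smul_mem _ _ (Submodule.subset_span ⟨_, hk i hi m h0, rfl⟩)
    | zero => rw [lie_zero]; exact Submodule.zero_mem _
    | add v w _ _ hv hw => rw [lie_add]; exact Submodule.add_mem _ hv hw
    | smul r v _ hv => rw [lie_smul]; exact Submodule.smul_mem _ _ hv
  rcases eq_bot_or_eq_top_of_stable hirr (Submodule.span ℂ (e '' T)) (key _ _ h.lie_L hf)
    (key _ _ h.lie_Y hg) with h0 | h0
  · obtain ⟨i, hi⟩ := hT
    have : e i ∈ Submodule.span ℂ (e '' T) := Submodule.subset_span ⟨i, hi, rfl⟩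
    rw [h0] at this
    exact absurd ((Submodule.mem_bot ℂ).mp this) (hTS hi)
  · refine Set.Subset.antisymm hTS fun i hi => by_contra fun hiT => ?_
    refine h.linearIndependent.notMem_span_image (s := {j | (j : ℤ) ∈ T}) (x := ⟨i, hi⟩) hiT ?_
    have : (fun j : {i | e i ≠ 0} => e j) '' {j | (j : ℤ) ∈ T} = e '' T := by
      ext v
      constructor
      · rintro ⟨j, hj, rfl⟩
        exact ⟨j, hj, rfl⟩
      · rintro ⟨j, hj, rfl⟩
        exact ⟨⟨j, hTS hj⟩, hj, rfl⟩
    rw [this, h0]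
    exact Submodule.mem_top

theorem exists_coeff_ne_zero (h : IsWeightBasis ϱ a e f g)
    (hnt : ¬ LieModule.IsTrivial (WAlg ϱ) V) (hg : ∀ p i, g p i = 0) : ∃ m i, f m i ≠ 0 := by
  by_contra! hf
  refine hnt ⟨fun x v => ?_⟩
  have hv := h.span_eq_top (Submodule.mem_top (x := v))
  induction hv using Submodule.span_induction with
  | mem v hv =>
    obtain ⟨i, rfl⟩ := hv
    rw [← Submodule.mem_bot ℂ]
    refine lie_mem_of_generators (fun m => ?_) (fun p => ?_) x
    · rw [h.lie_L, hf, zero_smul]; exact Submodule.zero_mem _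
    · rw [h.lie_Y, hg, zero_smul]; exact Submodule.zero_mem _
  | zero => rw [lie_zero]
  | add v w _ _ hv hw => rw [lie_add, hv, hw, add_zero]
  | smul r v _ hv => rw [lie_smul, hv, smul_zero]

theorem Y_lie_eq_zero (h : IsWeightBasis ϱ a e f g) (hg : ∀ p i, g p i = 0) (p : ℤ) (v : V) :
    ⁅Y ϱ p, v⁆ = 0 := by
  have hv := h.span_eq_top (Submodule.mem_top (x := v))
  induction hv using Submodule.span_induction with
  | mem v hv =>
    obtain ⟨i, rfl⟩ := hv
    rw [h.lie_Y, hg, zero_smul]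
  | zero => rw [lie_zero]
  | add v w _ _ hv hw => rw [lie_add, hv, hw, add_zero]
  | smul r v _ hv => rw [lie_smul, hv, smul_zero]

/-- The map `e_i ↦ c_i v_i` is a homomorphism into `A_{a,b,y}` if the `c_i` intertwine the coefficients. -/
theorem exists_lieModuleHom (h : IsWeightBasis ϱ a e f g) {b y : ℂ} (hy : ϱ = 0 ∨ y = 0)
    {c : ℤ → ℂ} (hcL : ∀ i m : ℤ, c (i + m) * f m i = (a + i + b * m) * c i)
    (hcY : ∀ i p : ℤ, c (i + p) * g p i = y * c i) :
    ∃ φ : V →ₗ⁅ℂ, WAlg ϱ⁆ IntermediateModule ϱ a b y hy,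
      ∀ i, e i ≠ 0 → φ (e i) = c i • IntermediateModule.v ϱ a b y hy i := by
  let B : Module.Basis {i | e i ≠ 0} ℂ V := Module.Basis.mk h.linearIndependent h.span_eq_top
  let φ : V →ₗ[ℂ] IntermediateModule ϱ a b y hy :=
    B.constr ℂ fun i => c i • IntermediateModule.v ϱ a b y hy i
  have hB : ∀ i : {i | e i ≠ 0}, B i = e i := fun i => Module.Basis.mk_apply _ _ i
  have hφ : ∀ i, e i ≠ 0 → φ (e i) = c i • IntermediateModule.v ϱ a b y hy i := fun i hi => by
    rw [← hB ⟨i, hi⟩, Module.Basis.constr_basis]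
  have hφ' : ∀ (i : ℤ) (r : ℂ), (e i = 0 → r = 0) →
      r • φ (e i) = (c i * r) • IntermediateModule.v ϱ a b y hy i := by
    intro i r hr
    by_cases hi : e i = 0
    · simp [hr hi]
    · rw [hφ i hi, smul_smul, mul_comm]
  refine ⟨{ φ with map_lie' := fun {x v} => ?_ }, hφ⟩
  change φ ⁅x, v⁆ = ⁅x, φ v⁆
  refine induction_basis ϱ (P := fun x => ∀ v, φ ⁅x, v⁆ = ⁅x, φ v⁆) x (fun x v => ?_) (by simp)
    (fun s t hs ht v => by rw [add_lie, map_add, hs, ht, add_lie])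
    (fun d s hs v => by rw [smul_lie, map_smul, hs, smul_lie]) v
  suffices H : φ ∘ₗ (LieModule.toEnd ℂ (WAlg ϱ) V (basis ϱ x)) =
      (LieModule.toEnd ℂ (WAlg ϱ) (IntermediateModule ϱ a b y hy) (basis ϱ x)) ∘ₗ φ
    from DFunLike.congr_fun H v
  refine B.ext fun i => ?_
  rw [hB]
  change φ ⁅basis ϱ x, e i⁆ = ⁅basis ϱ x, φ (e i)⁆
  rw [hφ i i.2, lie_smul]
  rcases x with m | p
  · change φ ⁅L ϱ m, e i⁆ = c i • ⁅L ϱ m, _⁆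
    rw [h.lie_L, map_smul, hφ' _ _ fun h0 => h.witt.target (not_not.mpr h0),
      IntermediateModule.lie_L_v, smul_smul, hcL, add_comm m, mul_comm]
  · change φ ⁅Y ϱ p, e i⁆ = c i • ⁅Y ϱ p, _⁆
    rw [h.lie_Y, map_smul, hφ' _ _ fun h0 => h.current.target (not_not.mpr h0),
      IntermediateModule.lie_Y_v, smul_smul, hcY, add_comm p, mul_comm]

end IsWeightBasis

/-- An irreducible module embedded in `M` is the subquotient `N / 0` of `M` with `N` its image. -/
theorem isNontrivialSimpleSubquotient_of_injective {M : Type*} [AddCommGroup M] [Module ℂ M]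
    [LieRingModule (WAlg ϱ) M] [LieModule ℂ (WAlg ϱ) M]
    (hirr : LieModule.IsIrreducible ℂ (WAlg ϱ) V) (hnt : ¬ LieModule.IsTrivial (WAlg ϱ) V)
    (φ : V →ₗ⁅ℂ, WAlg ϱ⁆ M) (hφ : Function.Injective φ) :
    IsNontrivialSimpleSubquotient ϱ M V := by
  let ψ : V →ₗ⁅ℂ, WAlg ϱ⁆ φ.range :=
    { (φ : V →ₗ[ℂ] M).codRestrict φ.range.toSubmodule fun v => ⟨v, rfl⟩ with
      map_lie' := fun {x v} => Subtype.ext (φ.map_lie x v) }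
  let q : V →ₗ⁅ℂ, WAlg ϱ⁆ φ.range ⧸ (⊥ : LieSubmodule ℂ (WAlg ϱ) φ.range) :=
    (LieSubmodule.Quotient.mk' _).comp ψ
  have hq : Function.Bijective q := by
    constructor
    · rw [injective_iff_map_eq_zero]
      intro v hv
      have h1 : ψ v ∈ (⊥ : LieSubmodule ℂ (WAlg ϱ) φ.range) :=
        (LieSubmodule.Quotient.mk_eq_zero _).mp hv
      have h2 : φ v = 0 := congrArg Subtype.val ((LieSubmodule.mem_bot _).mp h1)
      exact hφ (by rw [h2, map_zero])
    · refine (LieSubmodule.Quotient.surjective_mk' _).comp ?_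
      rintro ⟨_, v, rfl⟩
      exact ⟨v, rfl⟩
  let E := LinearEquiv.ofBijective q.toLinearMap hq
  let E' : V ≃ₗ⁅ℂ, WAlg ϱ⁆ φ.range ⧸ (⊥ : LieSubmodule ℂ (WAlg ϱ) φ.range) :=
    { q with
      invFun := E.symm
      left_inv := E.symm_apply_apply
      right_inv := E.apply_symm_apply }
  refine ⟨φ.range, ⊥, (LieSubmodule.orderIsoMapComap E').isSimpleOrder_iff.mp hirr,
    fun ht => hnt ⟨fun x v => hq.1 ?_⟩, ⟨E'⟩⟩
  rw [LieModuleHom.map_lie, map_zero]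
  exact ht.trivial x (q v)

theorem IsWeightBasis.isNontrivialSimpleSubquotient {a : ℂ} {e : ℤ → V} {f g : ℤ → ℤ → ℂ}
    (h : IsWeightBasis ϱ a e f g) (hirr : LieModule.IsIrreducible ℂ (WAlg ϱ) V)
    (hnt : ¬ LieModule.IsTrivial (WAlg ϱ) V) {b y : ℂ} (hy : ϱ = 0 ∨ y = 0)
    {c : ℤ → ℂ} (hc : ∀ i, e i ≠ 0 → c i ≠ 0)
    (hcL : ∀ i m : ℤ, c (i + m) * f m i = (a + i + b * m) * c i)
    (hcY : ∀ i p : ℤ, c (i + p) * g p i = y * c i) :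
    IsNontrivialSimpleSubquotient ϱ (IntermediateModule ϱ a b y hy) V := by
  obtain ⟨φ, hφ⟩ := h.exists_lieModuleHom hy hcL hcY
  refine isNontrivialSimpleSubquotient_of_injective hirr hnt φ ?_
  have := LieModule.nontrivial_of_isIrreducible ℂ (WAlg ϱ) V
  obtain ⟨i, hi⟩ : ∃ i, e i ≠ 0 := by
    by_contra! h0
    have h1 := h.span_eq_top
    have : IsEmpty {i | e i ≠ 0} := ⟨fun i => i.2 (h0 i)⟩
    rw [Set.range_eq_empty, Submodule.span_empty] at h1
    exact bot_ne_top (top_le_iff.mp h1)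
  have hker : φ.ker = ⊥ := by
    refine (hirr.eq_bot_or_eq_top φ.ker).resolve_right fun htop => ?_
    have h1 : φ (e i) = 0 := by
      rw [← LieModuleHom.mem_ker, htop]
      exact LieSubmodule.mem_top _
    rw [hφ i hi] at h1
    exact (smul_ne_zero (hc i hi) ((IntermediateModule.basis ϱ a b y hy).ne_zero i)) h1
  rw [injective_iff_map_eq_zero]
  intro v hv
  rwa [← LieModuleHom.mem_ker, hker, LieSubmodule.mem_bot] at hv

end Modules

/-! ### The classification -/

theorem theorem3p3 (ϱ : ℚ) (V : Type*) [AddCommGroup V] [Module ℂ V]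
    [LieRingModule (WAlg ϱ) V] [LieModule ℂ (WAlg ϱ) V]
    (hirr : LieModule.IsIrreducible ℂ (WAlg ϱ) V)
    (hnontriv : ¬ LieModule.IsTrivial (WAlg ϱ) V)
    (hweight : IsWeightModule ϱ V)
    (hmult : HasMultiplicityOne ϱ V) :
    (∀ h0 : ϱ = 0, ∃ a b c : ℂ,
      IsNontrivialSimpleSubquotient ϱ (IntermediateModule ϱ a b c (Or.inl h0)) V) ∧
    (ϱ ≠ 0 → ϱ ≠ -1 →
      (∃ a b : ℂ, IsNontrivialSimpleSubquotient ϱ (IntermediateModule ϱ a b 0 (Or.inr rfl)) V) ∧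
      ∀ (p : ℤ) (v : V), ⁅WAlg.Y ϱ p, v⁆ = 0) := by
  obtain ⟨a, e, f, g, he⟩ := exists_isWeightBasis hirr hweight hmult
  have hS := he.coeffIrreducible hirr
  -- once the `Y_p` act by zero, only the Witt algebra matters
  have hzero : (∀ p i, g p i = 0) → ∀ h : ϱ = 0 ∨ (0 : ℂ) = 0, ∃ b : ℂ,
      IsNontrivialSimpleSubquotient ϱ (IntermediateModule ϱ a b 0 h) V := by
    intro hg h
    have hg0 : g = 0 := by funext p i; exact hg p i
    obtain ⟨b, c, hc, hcL⟩ := he.witt.exists_intertwiner (hg0 ▸ hS)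
      (he.exists_coeff_ne_zero hnontriv hg)
    exact ⟨b, he.isNontrivialSimpleSubquotient hirr hnontriv h hc hcL fun i p => by simp [hg]⟩
  refine ⟨fun h0 => ?_, fun h0 h1 => ?_⟩
  · have hcur : CurrentCoeffs 0 {i | e i ≠ 0} f g := by simpa [h0] using he.current
    by_cases hY : ∀ i, g 0 i = 0
    · obtain ⟨b, hb⟩ := hzero (hcur.eq_zero_of_central_eq_zero he.witt hS hY) (Or.inl h0)
      exact ⟨a, b, 0, hb⟩
    · push Not at hY
      obtain ⟨j, hj⟩ := hY
      have hjS : j ∈ {i | e i ≠ 0} := by_contra fun hn => hj (hcur.source hn)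
      obtain ⟨b, c, hc, hcL, hcY⟩ := hcur.exists_intertwiner_of_central_ne_zero he.witt hS
        ⟨j, hjS⟩ hj fun i hi => hcur.central_eq_of_mem he.witt hS hi hjS
      exact ⟨a, b, g 0 j, he.isNontrivialSimpleSubquotient hirr hnontriv (Or.inl h0) hc hcL hcY⟩
  · have hg := he.current.eq_zero_of_ne (by exact_mod_cast h0) (by exact_mod_cast h1)
    obtain ⟨b, hb⟩ := hzero hg (Or.inr rfl)
    exact ⟨⟨a, b, hb⟩, he.Y_lie_eq_zero hg⟩
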